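/- **Corollary (Hamel–Goulden formulas for row flagged supersymmetric Schur functions).** *Setting.* Let $\mu\subseteq\lambda$ be partitions and $r\in\mathbb Z$. The r-shape $\lambda/\mu=(\lambda/\mu,r)$ is the skew diagram $\{(i,j): \mu_i<j\le\lambda_i\}$ (row $i$, column $j$, English notation) in which the position $(i,j)$ has content $c(i,j)=j-i+r-1+\ell(\lambda)$. Integer vectors $\mathbf a'=(a'_i),\mathbf b'=(b'_i)\in\mathbb Z^n$ with $n\ge\ell(\lambda)$ are row flags if $a'_i\le a'_{i+1}$ and $b'_i\le b'_{i+1}$ whenever $\mu_i<\lambda_{i+1}$. Let $\mathbf y=(y_i)_{i\in\mathbb Z}$ and $\mathbf z=(z_i)_{i\in\mathbb Z}$ be variables, write $\mathbf x_{p,q}=(x_p,\dots,x_q)$ (empty if $p>q$), and let $h_N(\mathbf x/\mathbf w)=\sum_{i=0}^N(-1)^{N-i}h_i(\mathbf x)e_{N-i}(\mathbf w)$, with $h_N=0$ for $N<0$. The row flagged supersymmetric Schur function is $$\overline{\mathsf S}^{\mathbf a',\mathbf b'}_{\lambda/\mu}(\mathbf y/\mathbf z)=\det\big[h_{\lambda_i-\mu_j-i+j}(\mathbf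 y_{a'_j,b'_i}/\mathbf z_{a_j,b_i})\big]_{1\le i,j\le n},\qquad a_j=a'_j+c(j,\mu_j+1),\quad b_i=b'_i+c(i,\lambda_i).$$ (Here $(j,\mu_j+1)$ and $(i,\lambda_i)$ are the leftmost cell of row $j$ and the rightmost cell of row $i$; entries of the flags at empty rows do not affect the determinant.) *Ribbons.* A ribbon is a nonempty connected skew diagram without a $2\times2$ block; its head is its bottom leftmost cell and its tail is its top rightmost cell. Let $\lambda/\mu$ be (edgewise) connected, and let $(\theta_1,\dots,\theta_k)$ be an outer ribbon decomposition: the $\theta_i$ are pairwise disjoint ribbons with union $\lambda/\mu$, each head $\delta_i$ lies on the left or bottom perimeter of $\lambda/\mu$, and each tail $\gamma_i$ lies on the top or right perimeter (a cell lies on the left perimeter if its left neighbour is not in $\lambda/\mu$, and similarly for the other three sides). A cell of $\theta_i$ goes up if the cell above it is in $\theta_i$, or if it is the tail of $\theta_i$ and lies on the top perimeter of $\lambda/\mu$; it goes right if the cell to its right is in $\theta_i$, or if it is the tail of $\theta_i$ and lies on the right perimeter. Every cell of $\lambda/\mu$ other than the top right one does exactly one of the two, and which one depends only on its content. For contents $p\le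 q$ of cells of $\lambda/\mu$, let $\Theta(p,q)$ be the ribbon with one cell of each content $p,p+1,\dots,q$, in which the cell of content $c<q$ is followed by the cell above it if the cells of content $c$ in $\lambda/\mu$ go up, and by the cell to its right if they go right; it is an r-shape with root content $p$. Moreover $\Theta(q+1,q)=\varnothing$, and $\Theta(p,q)$ is undefined for $p>q+1$. Put $\theta_i\#\theta_j=\Theta(c(\delta_i),c(\gamma_j))$. *Induced row ribbon flags.* Number the rows of $\theta_i\#\theta_j\ne\varnothing$ from top to bottom. For its $r$-th row let $m^{ij}_r$ be the leftmost cell of $\lambda/\mu$ having the content of the leftmost cell of that row, and let $M^{ij}_r$ be the rightmost cell of $\lambda/\mu$ having the content of the rightmost cell of that row. Put $a'^{ij}_r=a'_{\mathrm{row}(m^{ij}_r)}$ and $b'^{ij}_r=b'_{\mathrm{row}(M^{ij}_r)}$. *Statement.* For every connected r-shape $\lambda/\mu$, all row flags $\mathbf a',\mathbf b'\in\mathbb Z^n$ with $n\ge\ell(\lambda)$, and every outer ribbon decomposition $(\theta_1,\dots,\theta_k)$ of $\lambda/\mu$, $$\overline{\mathsf S}^{\mathbf a',\mathbf b'}_{\lambda/\mu}(\mathbf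 y/\mathbf z)=\det\Big[\overline{\mathsf S}^{\mathbf a'^{ij},\mathbf b'^{ij}}_{\theta_i\#\theta_j}(\mathbf y/\mathbf z)\Big]_{1\le i,j\le k},$$ where the $(i,j)$ entry is $1$ if $\theta_i\#\theta_j=\varnothing$ and $0$ if $\theta_i\#\theta_j$ is undefined. -/

import Mathlib

noncomputable section

open scoped Classical

namespace RowFlagged

/-! ### Supersymmetric functions of finite sets of variables -/

section Supersymmetric

variable {R : Type*} [CommRing R]

/-- Elementary symmetric function `e_k` of the variables `x_i`, `i ∈ s`. -/
def eSym (s : Finset ℤ) (x : ℤ → R) (k : ℕ) : R :=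
  MvPolynomial.aeval (fun i : s => x i) (MvPolynomial.esymm s ℤ k)

/-- Complete homogeneous symmetric function `h_k` of the variables `x_i`, `i ∈ s`. -/
def hSym (s : Finset ℤ) (x : ℤ → R) (k : ℕ) : R :=
  MvPolynomial.aeval (fun i : s => x i) (MvPolynomial.hsymm s ℤ k)

/-- Complete homogeneous supersymmetric function
`h_N(x_s / w_t) = ∑_{i = 0}^N (-1)^(N - i) h_i(x_s) e_{N - i}(w_t)`, with the usual convention
that it is `0` for `N < 0`. -/
def hSuper (s : Finset ℤ) (x : ℤ → R) (t : Finset ℤ) (w : ℤ → R) (N : ℤ) : R :=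
  if N < 0 then 0
  else ∑ i ∈ Finset.range (N.toNat + 1),
    (-1) ^ (N.toNat - i) * hSym s x i * eSym t w (N.toNat - i)

end Supersymmetric

/-! ### Skew shapes with shifted contents -/

/-- The graph on `ℕ × ℕ` (row, column) in which two cells are adjacent when they share an edge. -/
def cellGraph : SimpleGraph (ℕ × ℕ) :=
  SimpleGraph.fromRel fun x y =>
    (x.1 + 1 = y.1 ∧ x.2 = y.2) ∨ (x.1 = y.1 ∧ x.2 + 1 = y.2)

/-- A finite set of cells is edgewise connected. -/
def CellsConnected (T : Finset (ℕ × ℕ)) : Prop :=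
  (cellGraph.induce (T : Set (ℕ × ℕ))).Preconnected

/-- An r-shape `(λ/μ, r)`: `outer` is `λ`, `inner` is `μ`, `root` is `r`.
Rows and columns are numbered from `0`, English notation: row `0` is the top row. -/
structure RShape where
  outer : YoungDiagram
  inner : YoungDiagram
  inner_le : inner ≤ outer
  root : ℤ

namespace RShape

/-- The cells of `λ/μ`. -/
def cells (s : RShape) : Finset (ℕ × ℕ) := s.outer.cells \ s.inner.cells

/-- The length `ℓ(λ) = λ'_1`. -/
def length (s : RShape) : ℕ := s.outer.colLen 0

/-- Shifted content `j - i + r - 1 + λ'_1` of row `i` and column `j`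
(the difference `j - i` does not depend on whether numbering starts at `0` or at `1`). -/
def content (s : RShape) (i j : ℤ) : ℤ := j - i + s.root - 1 + s.length

/-- Content of the leftmost cell of row `i`, the cell in column `μ_i` (counting from `0`). -/
def leftContent (s : RShape) (i : ℕ) : ℤ := s.content i (s.inner.rowLen i)

/-- Content of the rightmost cell of row `i`, the cell in column `λ_i - 1` (counting from `0`). -/
def rightContent (s : RShape) (i : ℕ) : ℤ := s.content i ((s.outer.rowLen i : ℤ) - 1)

/-- Row flags. For `i ≥ ℓ(λ) - 1` the condition is void, and only the entries with index
`< ℓ(λ)` matter, so a row flag in `ℤ^n`, `n ≥ ℓ(λ)`, is the same as such a sequence, cut off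
after `n` entries. -/
def IsRowFlag (s : RShape) (a : ℕ → ℤ) : Prop :=
  ∀ i : ℕ, s.inner.rowLen i < s.outer.rowLen (i + 1) → a i ≤ a (i + 1)

/-- The row flagged supersymmetric Schur function, as an `n × n` determinant (`n ≥ ℓ(λ)`)
`det [h_{λ_i - μ_j - i + j}(y_{a'_j, b'_i} / z_{a_j, b_i})]`; here `a, b` are the flags conjugate
to `a', b'`, i.e. `a_j = a'_j + (content of the leftmost cell of row j)` and
`b_i = b'_i + (content of the rightmost cell of row i)`. -/
def rowFlaggedSchur {R : Type*} [CommRing R] (s : RShape) (n : ℕ) (a' b' : ℕ → ℤ)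
    (y z : ℤ → R) : R :=
  Matrix.det (Matrix.of fun i j : Fin n =>
    hSuper (Finset.Icc (a' j) (b' i)) y
      (Finset.Icc (a' j + s.leftContent j) (b' i + s.rightContent i)) z
      ((s.outer.rowLen i : ℤ) - s.inner.rowLen j - i + j))

/-- `row(min(c))`: the row of the leftmost cell of content `c`; on a diagonal the leftmost cell
is the topmost one. -/
def rowMin (s : RShape) (c : ℤ) : ℕ :=
  sInf {i : ℕ | ∃ j : ℕ, (i, j) ∈ s.cells ∧ s.content i j = c}

/-- `row(max(c))`: the row of the rightmost cell of content `c`; on a diagonal the rightmost cell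
is the lowest one. -/
def rowMax (s : RShape) (c : ℤ) : ℕ :=
  sSup {i : ℕ | ∃ j : ℕ, (i, j) ∈ s.cells ∧ s.content i j = c}

def OnLeftPerimeter (s : RShape) (x : ℕ × ℕ) : Prop :=
  ∀ w ∈ s.cells, ¬ (w.1 = x.1 ∧ w.2 + 1 = x.2)

def OnRightPerimeter (s : RShape) (x : ℕ × ℕ) : Prop :=
  ∀ w ∈ s.cells, ¬ (w.1 = x.1 ∧ w.2 = x.2 + 1)

def OnTopPerimeter (s : RShape) (x : ℕ × ℕ) : Prop :=
  ∀ w ∈ s.cells, ¬ (w.1 + 1 = x.1 ∧ w.2 = x.2)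

def OnBottomPerimeter (s : RShape) (x : ℕ × ℕ) : Prop :=
  ∀ w ∈ s.cells, ¬ (w.1 = x.1 + 1 ∧ w.2 = x.2)

end RShape

/-! ### Ribbons and outer ribbon decompositions -/

/-- A ribbon: a nonempty connected skew diagram without a `2 × 2` block of cells. -/
structure IsRibbon (T : Finset (ℕ × ℕ)) : Prop where
  nonempty : T.Nonempty
  skew : ∃ α β : YoungDiagram, β ≤ α ∧ T = α.cells \ β.cells
  connected : CellsConnected T
  no_block : ∀ i j : ℕ,
    ¬ ((i, j) ∈ T ∧ (i, j + 1) ∈ T ∧ (i + 1, j) ∈ T ∧ (i + 1, j + 1) ∈ T)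

/-- The head: the bottom leftmost cell. -/
def IsHead (T : Finset (ℕ × ℕ)) (x : ℕ × ℕ) : Prop :=
  x ∈ T ∧ ∀ w ∈ T, w.1 ≤ x.1 ∧ x.2 ≤ w.2

/-- The tail: the top rightmost cell. -/
def IsTail (T : Finset (ℕ × ℕ)) (x : ℕ × ℕ) : Prop :=
  x ∈ T ∧ ∀ w ∈ T, x.1 ≤ w.1 ∧ w.2 ≤ x.2

/-- An outer ribbon decomposition `(θ_1, …, θ_k)` of an r-shape, together with the heads `δ_i` and
the tails `γ_i` of its ribbons (which the ribbons determine). -/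
structure OuterDecomposition (s : RShape) (k : ℕ) where
  ribbon : Fin k → Finset (ℕ × ℕ)
  head : Fin k → ℕ × ℕ
  tail : Fin k → ℕ × ℕ
  isRibbon : ∀ i, IsRibbon (ribbon i)
  isHead : ∀ i, IsHead (ribbon i) (head i)
  isTail : ∀ i, IsTail (ribbon i) (tail i)
  disjoint : ∀ i j, i ≠ j → Disjoint (ribbon i) (ribbon j)
  cover : Finset.univ.biUnion ribbon = s.cells
  head_perimeter : ∀ i, s.OnLeftPerimeter (head i) ∨ s.OnBottomPerimeter (head i)
  tail_perimeter : ∀ i, s.OnTopPerimeter (tail i) ∨ s.OnRightPerimeter (tail i)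

/-! ### The ribbon with prescribed contents and directions -/

/-- The cell with content `t` in the ribbon whose contents are `p, …, q` and in which the cell of
content `c` is followed by the cell above it if `U c` holds and by the cell to its right otherwise.
Its row is the number of up steps after it and its column is the number of right steps before it. -/
def stripCell (U : ℤ → Prop) (p q t : ℤ) : ℕ × ℕ :=
  (((Finset.Ico t q).filter fun c => U c).card, ((Finset.Ico p t).filter fun c => ¬ U c).card)

/-- The ribbon with the cells `stripCell U p q t`, `p ≤ t ≤ q`, as an r-shape with root content
`p`: `outer` consists of the cells weakly north-west of some ribbon cell, and `inner` of the cells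
that are strictly north and strictly west of some ribbon cell. -/
def stripShape (U : ℤ → Prop) (p q : ℤ) : RShape where
  outer :=
    { cells := (Finset.Icc p q).biUnion fun t => Finset.Iic (stripCell U p q t)
      isLowerSet := by
        intro x w hwx hx
        simp only [Finset.coe_biUnion, Set.mem_iUnion, Finset.mem_coe, Finset.mem_Iic] at hx ⊢
        obtain ⟨t, ht, h⟩ := hx
        exact ⟨t, ht, hwx.trans h⟩ }
  inner :=
    { cells := (Finset.Icc p q).biUnion fun t =>
        Finset.range (stripCell U p q t).1 ×ˢ Finset.range (stripCell U p q t).2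
      isLowerSet := by
        intro x w hwx hx
        simp only [Finset.coe_biUnion, Set.mem_iUnion, Finset.mem_coe, Finset.mem_product,
          Finset.mem_range] at hx ⊢
        obtain ⟨t, ht, h1, h2⟩ := hx
        exact ⟨t, ht, lt_of_le_of_lt hwx.1 h1, lt_of_le_of_lt hwx.2 h2⟩ }
  inner_le := by
    intro x hx
    rw [← YoungDiagram.mem_cells] at hx ⊢
    simp only [Finset.mem_biUnion, Finset.mem_product, Finset.mem_range, Finset.mem_Iic] at hx ⊢
    obtain ⟨t, ht, h1, h2⟩ := hx
    exact ⟨t, ht, h1.le, h2.le⟩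
  root := p

/-- The cells of `stripShape` are exactly the prescribed ones. -/
theorem mem_stripShape_cells (U : ℤ → Prop) (p q : ℤ) (x : ℕ × ℕ) :
    x ∈ (stripShape U p q).cells ↔ ∃ t ∈ Finset.Icc p q, x = stripCell U p q t := by
  have rowAnti : ∀ t t' : ℤ, t ≤ t' → (stripCell U p q t').1 ≤ (stripCell U p q t).1 := by
    intro t t' h
    exact Finset.card_le_card (Finset.filter_subset_filter _ (Finset.Ico_subset_Ico h le_rfl))
  have colMono : ∀ t t' : ℤ, t ≤ t' → (stripCell U p q t).2 ≤ (stripCell U p q t').2 := by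
    intro t t' h
    exact Finset.card_le_card (Finset.filter_subset_filter _ (Finset.Ico_subset_Ico le_rfl h))
  have rowStep : ∀ t : ℤ, t < q →
      (stripCell U p q t).1 = (stripCell U p q (t + 1)).1 + if U t then 1 else 0 := by
    intro t h
    have e : Finset.Ico t q = insert t (Finset.Ico (t + 1) q) := by
      ext u; simp only [Finset.mem_Ico, Finset.mem_insert]; omega
    simp only [stripCell]
    rw [e, Finset.filter_insert]
    split_ifs
    · rw [Finset.card_insert_of_notMem (by simp)]
    · rfl
  have colStep : ∀ t : ℤ, p ≤ t →
      (stripCell U p q (t + 1)).2 = (stripCell U p q t).2 + if U t then 0 else 1 := by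
    intro t h
    have e : Finset.Ico p (t + 1) = insert t (Finset.Ico p t) := by
      ext u; simp only [Finset.mem_Ico, Finset.mem_insert]; omega
    simp only [stripCell]
    rw [e, Finset.filter_insert]
    by_cases hU : U t
    · simp [hU]
    · rw [if_pos hU, if_neg hU, Finset.card_insert_of_notMem (by simp)]
  have rowLast : (stripCell U p q q).1 = 0 := by simp [stripCell]
  have colFirst : (stripCell U p q p).2 = 0 := by simp [stripCell]
  simp only [RShape.cells, stripShape, Finset.mem_sdiff, Finset.mem_biUnion, Finset.mem_Iic,
    Finset.mem_product, Finset.mem_range, not_exists, not_and]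
  constructor
  · rintro ⟨⟨t, ht, hx⟩, hin⟩
    have ht' := Finset.mem_Icc.1 ht
    obtain ⟨s, hs, hmax⟩ := ((Finset.Icc p q).filter
      fun u => x.1 ≤ (stripCell U p q u).1).exists_max_image id
      ⟨t, Finset.mem_filter.2 ⟨ht, hx.1⟩⟩
    obtain ⟨hsI, hsr⟩ := Finset.mem_filter.1 hs
    have hsI' := Finset.mem_Icc.1 hsI
    have hts : t ≤ s := hmax t (Finset.mem_filter.2 ⟨ht, hx.1⟩)
    have hcol : x.2 ≤ (stripCell U p q s).2 := hx.2.trans (colMono t s hts)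
    have hrow : (stripCell U p q s).1 = x.1 := by
      by_cases hsq : s = q
      · subst hsq; omega
      · have hlt : s < q := lt_of_le_of_ne hsI'.2 hsq
        have h1 := rowStep s hlt
        have h2 : ¬ x.1 ≤ (stripCell U p q (s + 1)).1 := by
          intro h
          have := hmax (s + 1) (Finset.mem_filter.2 ⟨Finset.mem_Icc.2 ⟨by omega, by omega⟩, h⟩)
          simp only [id] at this
          omega
        split_ifs at h1 <;> omega
    obtain ⟨v, hv, hvmax⟩ := ((Finset.Icc p s).filter
      fun u => (stripCell U p q u).2 ≤ x.2).exists_max_image id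
      ⟨p, Finset.mem_filter.2 ⟨Finset.mem_Icc.2 ⟨le_rfl, hsI'.1⟩, by omega⟩⟩
    obtain ⟨hvI, hvc⟩ := Finset.mem_filter.1 hv
    have hvI' := Finset.mem_Icc.1 hvI
    by_cases hvs : v = s
    · subst hvs
      exact ⟨v, hsI, Prod.ext hrow.symm (le_antisymm hcol hvc)⟩
    · have hlt : v < s := lt_of_le_of_ne hvI'.2 hvs
      have h1 := colStep v hvI'.1
      have h2 : ¬ (stripCell U p q (v + 1)).2 ≤ x.2 := by
        intro h
        have := hvmax (v + 1) (Finset.mem_filter.2 ⟨Finset.mem_Icc.2 ⟨by omega, by omega⟩, h⟩)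
        simp only [id] at this
        omega
      have h3 := rowStep v (by omega)
      have h4 := rowAnti (v + 1) s (by omega)
      have h5 := hin (v + 1) (Finset.mem_Icc.2 ⟨by omega, by omega⟩)
      by_cases hU : U v
      · rw [if_pos hU] at h1; omega
      · rw [if_neg hU] at h1 h3
        refine ⟨v, Finset.mem_Icc.2 ⟨hvI'.1, by omega⟩, Prod.ext ?_ ?_⟩
        · by_contra hne
          exact h5 (by omega) (by omega)
        · omega
  · rintro ⟨t, ht, rfl⟩
    refine ⟨⟨t, ht, le_rfl⟩, ?_⟩
    intro u _ h1 h2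
    rcases le_total t u with h | h
    · have := rowAnti t u h; omega
    · have := colMono u t h; omega

namespace OuterDecomposition

variable {s : RShape} {k : ℕ}

/-- The cell `x` goes up: the cell above it is in the same ribbon, or it is the tail of its ribbon
and lies on the top perimeter. -/
def GoesUp (D : OuterDecomposition s k) (x : ℕ × ℕ) : Prop :=
  ∃ i, x ∈ D.ribbon i ∧
    ((∃ w ∈ D.ribbon i, w.1 + 1 = x.1 ∧ w.2 = x.2) ∨ (x = D.tail i ∧ s.OnTopPerimeter x))

/-- The cell of content `c` of the cutting strip goes up. For a connected shape, the cells of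
content `c` all go up or all go right, except that the direction of the top right cell (the
last cell of the strip) has no influence on the strip or on any of its sub-ribbons. -/
def StripUp (D : OuterDecomposition s k) (c : ℤ) : Prop :=
  ∃ x ∈ s.cells, s.content x.1 x.2 = c ∧ D.GoesUp x

/-- `Θ(p, q)` for `p ≤ q`: the sub-ribbon of the cutting strip with contents in `[p, q]`, as an
r-shape with root content `p`. -/
def strip (D : OuterDecomposition s k) (p q : ℤ) : RShape := stripShape D.StripUp p q

/-- `c(δ_i)`, the content of the head of `θ_i`. -/
def headContent (D : OuterDecomposition s k) (i : Fin k) : ℤ :=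
  s.content (D.head i).1 (D.head i).2

/-- `c(γ_i)`, the content of the tail of `θ_i`. -/
def tailContent (D : OuterDecomposition s k) (i : Fin k) : ℤ :=
  s.content (D.tail i).1 (D.tail i).2

/-- Induced row ribbon flag `a'^{ij}`, for the ribbon `θ_i # θ_j = Θ(p, q)`: the entry that belongs
to row `r` of the ribbon is `a'_{row(m)}`, where `m` is the leftmost cell of `λ/μ` with the content
of the leftmost cell of row `r`. Rows are counted from the top, as for all row flags. -/
def inducedLower (D : OuterDecomposition s k) (a' : ℕ → ℤ) (p q : ℤ) (r : ℕ) : ℤ :=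
  a' (s.rowMin ((D.strip p q).leftContent r))

/-- Induced row ribbon flag `b'^{ij}`: the entry that belongs to row `r` of the ribbon is
`b'_{row(M)}`, where `M` is the rightmost cell of `λ/μ` with the content of the rightmost cell of
row `r`. -/
def inducedUpper (D : OuterDecomposition s k) (b' : ℕ → ℤ) (p q : ℤ) (r : ℕ) : ℤ :=
  b' (s.rowMax ((D.strip p q).rightContent r))

/-- The matrix entry for `θ_i # θ_j = Θ(c(δ_i), c(γ_j))`; it is `1` if `θ_i # θ_j` is empty and `0`
if it is undefined. -/
def entry {R : Type*} [CommRing R] (D : OuterDecomposition s k) (a' b' : ℕ → ℤ) (y z : ℤ → R)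
    (i j : Fin k) : R :=
  let p := D.headContent i
  let q := D.tailContent j
  if p ≤ q then
    (D.strip p q).rowFlaggedSchur (D.strip p q).length
      (D.inducedLower a' p q) (D.inducedUpper b' p q) y z
  else if p = q + 1 then 1
  else 0

end OuterDecomposition

end RowFlagged

end

noncomputable section

open scoped Classical

namespace RowFlagged

/-! ### Determinants and elementary operations -/

section Determinants

variable {ι R : Type*} [Fintype ι] [DecidableEq ι] [CommRing R]

/-! Both sides are evaluations of one determinant attached to the cells of the shape. The lower flag
of a nonempty row is determined by the content of its leftmost cell, the upper flag by the content
of its rightmost cell. Hence a Jacobi-Trudi entry has the form `M l r` with contents `l`, `r` and `M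
= rowKernel`. About `M` only `M p p = 1` and `M p q = 0` for `q < p` are needed; symmetric functions
play no further role.

From `M` one forms ribbon functions (`ribbonKernel`). They are the Jacobi-Trudi determinants of
ribbons (`det_ribbon`) and obey the product rule for concatenation, side by side or on top of each
other (`ribbonKernel_toggle`).

Let `W` be the set of contents whose cells are entered from below, the others being entered from the
left. In `cellMatrix` the row of a cell with a predecessor in the shape is minus the unit vector at
that predecessor, and every other row consists of ribbon functions. The predecessor relation cuts
the shape into chains, and `det_chains` collapses the determinant to one that pairs starts of chains
with ends of chains. If `W` is empty, the chains are the rows of the shape and the result is the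
Jacobi-Trudi determinant. If `W` comes from the cutting strip, the chains are the ribbons of the
decomposition and the result is the determinant of ribbon functions.

It remains that the determinant does not depend on `W`, and one content `w` can be changed at a time
(`det_cellMatrix_toggle`). The diagonals of content `w` and `w - 1` interlace, so the unit rows of
diagonal `w` before and after the change agree up to sign and a shift by one cell. By the product
rule the rows outside that diagonal change by a rank one matrix. One exceptional row remains, and it
is settled by elementary operations. -/

/-- Adding multiples of one column to the other columns preserves the determinant. -/
theorem det_eq_of_forall_col_eq_smul_add_const {A B : Matrix ι ι R} (c : ι → R) (k : ι)
    (hk : c k = 0) (h : ∀ i j, A i j = B i j + c j * B i k) : A.det = B.det := by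
  rw [← Matrix.det_transpose A, ← Matrix.det_transpose B]
  exact Matrix.det_eq_of_forall_row_eq_smul_add_const c k hk fun i j => h j i

/-- Adding linear combinations of a set of rows to the other rows preserves the determinant. -/
theorem det_eq_of_rows_add_sum {A B : Matrix ι ι R} (S : Finset ι) (c : ι → ι → R)
    (hc : ∀ x ∈ S, ∀ r, c x r = 0)
    (h : ∀ x j, B x j = A x j + ∑ r ∈ S, c x r * A r j) : B.det = A.det := by
  induction S using Finset.induction_on generalizing B with
  | empty =>
    congr 1
    ext x j
    simp [h]
  | insert r S hr ih =>
    have h1 := ih (B := Matrix.of fun x j => A x j + ∑ r ∈ S, c x r * A r j)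
      (fun x hx => hc x (Finset.mem_insert_of_mem hx)) (fun x j => rfl)
    rw [← h1]
    -- By `hc` the rows in the set are never altered, so row `r` of the intermediate matrix is still
    -- row `r` of `A`.
    refine Matrix.det_eq_of_forall_row_eq_smul_add_const (fun x => c x r) r
      (hc r (Finset.mem_insert_self _ _) r) fun x j => ?_
    rw [h, Finset.sum_insert hr]
    simp [hc r (Finset.mem_insert_self _ _)]
    ring

/-- Rows that are negatives of unit vectors clear the corresponding columns. -/
theorem det_clear_columns {A B : Matrix ι ι R} (S : Finset ι) (m : ι → ι)
    (hA : ∀ r ∈ S, ∀ j, A r j = if j = m r then -1 else 0)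
    (hB : ∀ r ∈ S, ∀ j, B r j = A r j)
    (hm : ∀ r ∈ S, ∀ r' ∈ S, m r = m r' → r = r')
    (h0 : ∀ x ∉ S, ∀ r ∈ S, B x (m r) = 0)
    (h1 : ∀ x ∉ S, ∀ j, (∀ r ∈ S, j ≠ m r) → B x j = A x j) : B.det = A.det := by
  -- Row `r` is minus the unit vector at `m r`, so adding `A x (m r)` times it removes exactly the
  -- entry of row `x` in that column.
  refine det_eq_of_rows_add_sum S (fun x r => if x ∈ S then 0 else A x (m r))
    (fun x hx r => by simp [hx]) fun x j => ?_
  by_cases hx : x ∈ S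
  · simp [hx, hB]
  · simp only [hx, if_false]
    by_cases hj : ∃ r ∈ S, j = m r
    · obtain ⟨r, hr, rfl⟩ := hj
      rw [h0 x hx r hr, Finset.sum_eq_single r]
      · rw [hA r hr, if_pos rfl]; ring
      · intro r' hr' hne
        rw [hA r' hr', if_neg, mul_zero]
        exact fun h => hne (hm r' hr' r hr h.symm)
      · exact fun h => (h hr).elim
    · push Not at hj
      rw [h1 x hx j hj, Finset.sum_eq_zero, add_zero]
      intro r hr
      rw [hA r hr, if_neg (hj r hr), mul_zero]

/-- Exchanging two rows and changing the sign of one of them preserves the determinant. -/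
theorem det_swap_neg {A B : Matrix ι ι R} {a b : ι} (hab : a ≠ b)
    (ha : ∀ j, B a j = -A b j) (hb : ∀ j, B b j = A a j)
    (h : ∀ x, x ≠ a → x ≠ b → ∀ j, B x j = A x j) : B.det = A.det := by
  have hB : B = Matrix.of fun i j =>
      (if i = a then (-1 : R) else 1) * A.submatrix (Equiv.swap a b) id i j := by
    ext i j
    by_cases hia : i = a
    · subst hia; simp [ha]
    · by_cases hib : i = b
      · subst hib; simp [hia, hb]
      · simp [hia, h i hia hib, Equiv.swap_apply_of_ne_of_ne hia hib]
  rw [hB, Matrix.det_mul_column, Matrix.det_permute, Equiv.Perm.sign_swap hab]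
  simp [Finset.prod_ite_eq']

/-- Moving a row down along a sequence of rows, while the rows that it passes move up by one and
change sign, preserves the determinant. -/
theorem det_slide (e : ℕ → ι) (m : ℕ) {A B : Matrix ι ι R}
    (he : ∀ k ≤ m, ∀ l ≤ m, e k = e l → k = l)
    (hlt : ∀ k < m, ∀ j, B (e k) j = -A (e (k + 1)) j)
    (hlast : ∀ j, B (e m) j = A (e 0) j)
    (h : ∀ x, (∀ k ≤ m, x ≠ e k) → ∀ j, B x j = A x j) : B.det = A.det := by
  induction m generalizing B with
  | zero =>
    congr 1
    ext x j
    by_cases hx : x = e 0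
    · rw [hx, hlast]
    · exact h x (fun k hk => by rwa [Nat.le_zero.1 hk]) j
  | succ m ih =>
    have hne : e m ≠ e (m + 1) := fun h => by
      have := he m (by omega) (m + 1) le_rfl h
      omega
    -- The state in which the row of `e 0` has reached `e m`; a single signed exchange with `e (m +
    -- 1)` remains.
    let A₁ : Matrix ι ι R := Matrix.of fun x j =>
      if x = e m then A (e 0) j else if x = e (m + 1) then A (e (m + 1)) j else B x j
    have hne' : ∀ k < m, e k ≠ e m ∧ e k ≠ e (m + 1) := fun k hk =>
      ⟨fun h => by have := he k (by omega) m (by omega) h; omega,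
        fun h => by have := he k (by omega) (m + 1) le_rfl h; omega⟩
    have h1 : A₁.det = A.det := by
      refine ih (fun k hk l hl => he k (by omega) l (by omega)) ?_ ?_ ?_
      · intro k hk j
        simp only [A₁, Matrix.of_apply]
        rw [if_neg (hne' k hk).1, if_neg (hne' k hk).2, hlt k (by omega)]
      · intro j
        simp [A₁]
      · intro x hx j
        simp only [A₁, Matrix.of_apply]
        rw [if_neg (hx m le_rfl)]
        split_ifs with hxm
        · rw [hxm]
        · refine h x (fun k hk => ?_) j
          rcases Nat.lt_or_ge m k with hk' | hk'
          · rwa [show k = m + 1 by omega]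
          · exact hx k hk'
    rw [← h1]
    refine det_swap_neg hne ?_ ?_ ?_
    · intro j
      rw [hlt m (by omega)]
      simp [A₁, hne.symm]
    · intro j
      rw [hlast]
      simp [A₁]
    · intro x hx hx' j
      simp [A₁, hx, hx']

/-- The determinant of a matrix which has rows `-δ_{prev x}` along chains: it is the determinant of
the matrix whose rows belong to the first elements and whose columns belong to the last elements of
the chains. -/
theorem det_chains {κ : Type*} [Fintype κ] [DecidableEq κ] (len : κ → ℕ) (e : κ → ℕ → ι)
    (hinj : ∀ i k j l, k ≤ len i → l ≤ len j → e i k = e j l → i = j ∧ k = l)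
    (hcov : ∀ x, ∃ i, ∃ k ≤ len i, x = e i k) (A : Matrix ι ι R)
    (hA : ∀ i, ∀ k < len i, ∀ y, A (e i (k + 1)) y = if y = e i k then -1 else 0) :
    A.det = Matrix.det (Matrix.of fun i j : κ => A (e i 0) (e j (len j))) := by
  -- `T` collects the chains along which the first row has already been slid to the end. Sliding
  -- turns `-δ` at the preceding element into `+δ` at the element itself.
  have key : ∀ T : Finset κ, ∀ B : Matrix ι ι R,
      (∀ i ∈ T, ∀ k < len i, ∀ y, B (e i k) y = if y = e i k then 1 else 0) →
      (∀ i ∈ T, ∀ y, B (e i (len i)) y = A (e i 0) y) →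
      (∀ i ∉ T, ∀ k ≤ len i, ∀ y, B (e i k) y = A (e i k) y) → B.det = A.det := by
    intro T
    induction T using Finset.induction_on with
    | empty =>
      intro B _ _ h
      congr 1
      ext x y
      obtain ⟨i, k, hk, rfl⟩ := hcov x
      exact h i (by simp) k hk y
    | insert t T ht ih =>
      intro B h1 h2 h3
      let B₁ : Matrix ι ι R := Matrix.of fun x y => if ∃ k ≤ len t, x = e t k then A x y else B x y
      have hB₁ : ∀ i ≠ t, ∀ k ≤ len i, ∀ y, B₁ (e i k) y = B (e i k) y := by
        intro i hi k hk y
        simp only [B₁, Matrix.of_apply]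
        rw [if_neg]
        rintro ⟨l, hl, h⟩
        exact hi (hinj i k t l hk hl h).1
      have hB₁t : ∀ k ≤ len t, ∀ y, B₁ (e t k) y = A (e t k) y := by
        intro k hk y
        simp only [B₁, Matrix.of_apply]
        rw [if_pos ⟨k, hk, rfl⟩]
      have hd : B₁.det = A.det := by
        refine ih B₁ ?_ ?_ ?_
        · intro i hi k hk y
          rw [hB₁ i (fun h => ht (h ▸ hi)) k hk.le, h1 i (Finset.mem_insert_of_mem hi) k hk]
        · intro i hi y
          rw [hB₁ i (fun h => ht (h ▸ hi)) _ le_rfl, h2 i (Finset.mem_insert_of_mem hi)]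
        · intro i hi k hk y
          by_cases hit : i = t
          · subst hit; exact hB₁t k hk y
          · rw [hB₁ i hit k hk, h3 i (by simp [hit, hi]) k hk]
      rw [← hd]
      refine det_slide (e t) (len t) (fun k hk l hl h => (hinj t k t l hk hl h).2) ?_ ?_ ?_
      · intro k hk y
        rw [h1 t (Finset.mem_insert_self _ _) k hk, hB₁t _ (by omega), hA t k hk]
        split_ifs <;> simp
      · intro y
        rw [h2 t (Finset.mem_insert_self _ _), hB₁t 0 (by omega)]
      · intro x hx y
        simp only [B₁, Matrix.of_apply]
        rw [if_neg]
        rintro ⟨k, hk, h⟩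
        exact hx k hk h
  let p : ι → Prop := fun x => ∃ i, x = e i (len i)
  let B : Matrix ι ι R := Matrix.of fun x y =>
    if h : p x then A (e h.choose 0) y else if y = x then 1 else 0
  have hpe : ∀ i, ∃ h : p (e i (len i)), h.choose = i := fun i => by
    have h : p (e i (len i)) := ⟨i, rfl⟩
    exact ⟨h, (hinj _ _ _ _ le_rfl le_rfl h.choose_spec).1.symm⟩
  have hpn : ∀ i, ∀ k < len i, ¬ p (e i k) := by
    rintro i k hk ⟨j, hj⟩
    obtain ⟨rfl, h⟩ := hinj i k j (len j) hk.le le_rfl hj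
    omega
  have hBt : ∀ i y, B (e i (len i)) y = A (e i 0) y := by
    intro i y
    obtain ⟨h, hi⟩ := hpe i
    simp only [B, Matrix.of_apply]
    rw [dif_pos h, hi]
  rw [← key Finset.univ B]
  -- Away from the last elements of chains the rows are now unit vectors on the diagonal, so that
  -- block is the identity.
  · rw [Matrix.twoBlockTriangular_det B p]
    · have h1 : (Matrix.toSquareBlockProp B fun x => ¬ p x) = 1 := by
        ext ⟨x, hx⟩ ⟨y, hy⟩
        simp only [Matrix.toSquareBlockProp_def, B, Matrix.of_apply, dif_neg hx, Matrix.one_apply,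
          Subtype.mk.injEq]
        simp only [eq_comm]
      rw [h1, Matrix.det_one, mul_one]
      let f : κ ≃ {x // p x} := Equiv.ofBijective (fun i => ⟨e i (len i), i, rfl⟩)
        ⟨fun i j h => (hinj _ _ _ _ le_rfl le_rfl (Subtype.mk.inj h)).1,
          fun ⟨x, i, hi⟩ => ⟨i, Subtype.ext hi.symm⟩⟩
      rw [← Matrix.det_submatrix_equiv_self f]
      congr 1
      ext i j
      exact hBt i _
    · intro x hx y hy
      simp only [B, Matrix.of_apply]
      rw [dif_neg hx, if_neg]
      rintro rfl
      exact hx hy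
  · intro i _ k hk y
    simp only [B, Matrix.of_apply]
    rw [dif_neg (hpn i k hk)]
  · exact fun i _ y => hBt i y
  · exact fun i hi => (hi (Finset.mem_univ i)).elim

end Determinants

/-! ### Ribbon kernels -/

section Kernel

variable {R : Type*} [CommRing R]

/-- Auxiliary recursion for `ribbonKernel`: the breaks are the points of `W` in `(p, p + d]`. -/
def ribbonKernelAux (M : ℤ → ℤ → R) (W : ℤ → Prop) : ℕ → ℤ → ℤ → R
  | 0, p, q => M p q
  | d + 1, p, q =>
    if W (p + d + 1) then
      M (p + d + 1) q * ribbonKernelAux M W d p (p + d + 1) - ribbonKernelAux M W d p q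
    else ribbonKernelAux M W d p q

/-- The generalized ribbon Schur function of the ribbon with the contents `p, …, q - 1` whose rows
begin at `p` and at the points of `W` in `(p, q)`; here `M l r` is the function of the row with the
contents `l, …, r - 1`. -/
def ribbonKernel (M : ℤ → ℤ → R) (W : ℤ → Prop) (p q : ℤ) : R :=
  if p < q then ribbonKernelAux M W (q - p - 1).toNat p q else if p = q then 1 else 0

variable (M : ℤ → ℤ → R) (W W' : ℤ → Prop)

theorem ribbonKernelAux_congr (d : ℕ) (p q : ℤ) (h : ∀ t, p < t → t ≤ p + d → (W t ↔ W' t)) :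
    ribbonKernelAux M W d p q = ribbonKernelAux M W' d p q := by
  induction d generalizing q with
  | zero => rfl
  | succ d ih =>
    have h1 := fun q => ih q fun t h1 h2 => h t h1 (by push_cast; omega)
    simp only [ribbonKernelAux, h1, h (p + d + 1) (by omega) (by push_cast; omega)]

theorem ribbonKernelAux_of_forall_not (d : ℕ) (p q : ℤ) (h : ∀ t, p < t → t ≤ p + d → ¬ W t) :
    ribbonKernelAux M W d p q = M p q := by
  induction d with
  | zero => rfl
  | succ d ih =>
    rw [ribbonKernelAux, if_neg (h _ (by omega) (by push_cast; omega)),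
      ih fun t h1 h2 => h t h1 (by push_cast; omega)]

/-- The recursion exposes only the last break, whereas `w` may be any break. For `j = 0` the
identity is the recursion at `w` itself. Each later step, with or without a break, is linear in the
kernels starting at `p` and carries the identity along. -/
theorem ribbonKernelAux_toggle (w p q : ℤ) (e : ℕ) (hw : w = p + e + 1) (hW : ¬ W w)
    (hW' : ∀ t, W' t ↔ W t ∨ t = w) (j : ℕ) :
    ribbonKernelAux M W' (e + 1 + j) p q =
      ribbonKernelAux M W j w q * ribbonKernelAux M W e p w
        - ribbonKernelAux M W (e + 1 + j) p q := by
  have he : ∀ q, ribbonKernelAux M W' e p q = ribbonKernelAux M W e p q := fun q =>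
    ribbonKernelAux_congr M W' W e p q fun t h1 h2 => by
      rw [hW']
      exact ⟨fun h => h.resolve_right (by omega), Or.inl⟩
  induction j generalizing q with
  | zero =>
    simp only [ribbonKernelAux, ← hw, hW, if_false, he, (hW' w).2 (Or.inr rfl), if_true]
  | succ j ih =>
    have h1 : p + ((e + 1 + j : ℕ) : ℤ) + 1 = w + j + 1 := by rw [hw]; push_cast; ring
    have h2 : W' (w + j + 1) ↔ W (w + j + 1) := by
      rw [hW']
      exact ⟨fun h => h.resolve_right (by omega), Or.inl⟩
    rw [show e + 1 + (j + 1) = (e + 1 + j) + 1 by ring]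
    simp only [ribbonKernelAux, h1, h2, ih]
    split_ifs <;> ring

theorem ribbonKernel_self (p : ℤ) : ribbonKernel M W p p = 1 := by simp [ribbonKernel]

theorem ribbonKernel_of_lt {p q : ℤ} (h : q < p) : ribbonKernel M W p q = 0 := by
  rw [ribbonKernel, if_neg (by omega), if_neg (by omega)]

theorem ribbonKernel_congr {p q : ℤ} (h : ∀ t, p < t → t < q → (W t ↔ W' t)) :
    ribbonKernel M W p q = ribbonKernel M W' p q := by
  unfold ribbonKernel
  split_ifs with h1
  · exact ribbonKernelAux_congr M W W' _ p q fun t h2 h3 => h t h2 (by omega)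
  · rfl
  · rfl

theorem ribbonKernel_of_forall_not {p q : ℤ} (hpq : p < q) (h : ∀ t, p < t → t < q → ¬ W t) :
    ribbonKernel M W p q = M p q := by
  rw [ribbonKernel, if_pos hpq]
  exact ribbonKernelAux_of_forall_not M W _ p q fun t h2 h3 => h t h2 (by omega)

/-- The product rule for ribbon Schur functions. -/
theorem ribbonKernel_toggle {w p q : ℤ} (hp : p < w) (hq : w < q) (hW : ¬ W w)
    (hW' : ∀ t, W' t ↔ W t ∨ t = w) :
    ribbonKernel M W' p q =
      ribbonKernel M W p w * ribbonKernel M W w q - ribbonKernel M W p q := by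
  simp only [ribbonKernel, if_pos hp, if_pos hq, if_pos (hp.trans hq)]
  have h := ribbonKernelAux_toggle M W W' w p q (w - p - 1).toNat (by omega) hW hW'
    (q - w - 1).toNat
  rw [show (w - p - 1).toNat + 1 + (q - w - 1).toNat = (q - p - 1).toNat by omega] at h
  rw [h, mul_comm]

end Kernel

/-! ### Comparison of matrices that differ by a rank one matrix and in one row -/

section RankOne

variable {ι R : Type*} [Fintype ι] [DecidableEq ι] [CommRing R]

/-- This lemma and the next three treat the four possible forms of the exceptional row `r` in
`det_cellMatrix_toggle`, according to which ends of the neighbouring diagonal are present. -/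
theorem det_eq_of_row_eq {X Y : Matrix ι ι R} {r : ι} {φ g : ι → R} (hφ : φ r = 0)
    (h : ∀ x ≠ r, ∀ y, Y x y = X x y + φ x * g y)
    (hX : ∀ y, X r y = g y) (hY : ∀ y, Y r y = g y) : X.det = Y.det := by
  symm
  refine Matrix.det_eq_of_forall_row_eq_smul_add_const φ r hφ fun x y => ?_
  by_cases hx : x = r
  · subst hx; rw [hX, hY, hφ]; ring
  · rw [h x hx, hX]

theorem det_eq_of_row_sub_single {X Y : Matrix ι ι R} {r b : ι} {φ g : ι → R} (hφ : φ r = 0)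
    (h : ∀ x ≠ r, ∀ y, Y x y = X x y + φ x * g y) (hg : g b = 0) (hb : ∀ x ≠ r, X x b = φ x)
    (hX : ∀ y, X r y = g y - if y = b then 1 else 0)
    (hY : ∀ y, Y r y = -if y = b then 1 else 0) : X.det = Y.det := by
  -- After these row operations both matrices agree outside row `r`, and their column `b` vanishes
  -- there. Multiples of column `b` then adjust row `r` alone.
  let X₂ : Matrix ι ι R := Matrix.of fun x y => X x y + φ x * X r y
  let Y₂ : Matrix ι ι R := Matrix.of fun x y => Y x y + φ x * Y r y
  have h1 : X₂.det = X.det :=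
    Matrix.det_eq_of_forall_row_eq_smul_add_const φ r hφ fun x y => rfl
  have h2 : Y₂.det = Y.det :=
    Matrix.det_eq_of_forall_row_eq_smul_add_const φ r hφ fun x y => rfl
  rw [← h1, ← h2]
  refine det_eq_of_forall_col_eq_smul_add_const (fun y => -g y) b (by simp [hg]) fun x y => ?_
  simp only [X₂, Y₂, Matrix.of_apply]
  by_cases hx : x = r
  · subst hx
    rw [hX, hY, hY, hφ, if_pos rfl]
    ring
  · rw [h x hx, h x hx, hX, hY, hY, hb x hx, hg, if_pos rfl]
    ring

theorem det_eq_of_row_add_single {X Y : Matrix ι ι R} {r b : ι} {φ g : ι → R} (hφ : φ r = 0)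
    (h : ∀ x ≠ r, ∀ y, Y x y = X x y + φ x * g y) (hg : g b = 0) (hb : ∀ x ≠ r, X x b = φ x)
    (hX : ∀ y, X r y = if y = b then 1 else 0)
    (hY : ∀ y, Y r y = g y + if y = b then 1 else 0) : X.det = Y.det := by
  let X₂ : Matrix ι ι R := Matrix.of fun x y => X x y + -φ x * X r y
  let Y₂ : Matrix ι ι R := Matrix.of fun x y => Y x y + -φ x * Y r y
  have h1 : X₂.det = X.det :=
    Matrix.det_eq_of_forall_row_eq_smul_add_const (fun x => -φ x) r (by simp [hφ]) fun x y => rfl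
  have h2 : Y₂.det = Y.det :=
    Matrix.det_eq_of_forall_row_eq_smul_add_const (fun x => -φ x) r (by simp [hφ]) fun x y => rfl
  rw [← h1, ← h2]
  refine det_eq_of_forall_col_eq_smul_add_const (fun y => -g y) b (by simp [hg]) fun x y => ?_
  simp only [X₂, Y₂, Matrix.of_apply]
  by_cases hx : x = r
  · subst hx
    rw [hX, hY, hY, hφ, if_pos rfl, hg]
    ring
  · rw [h x hx, h x hx, hX, hY, hY, hb x hx, hg, if_pos rfl]
    ring

theorem det_eq_of_row_single {X Y : Matrix ι ι R} {r b b' : ι} {φ g : ι → R} (hbb : b ≠ b')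
    (h : ∀ x ≠ r, ∀ y, Y x y = X x y + φ x * g y) (hg : g b = 0) (hg' : g b' = 0)
    (hb : ∀ x ≠ r, X x b = φ x) (hb' : ∀ x ≠ r, X x b' = φ x)
    (hX : ∀ y, X r y = if y = b then 1 else 0)
    (hY : ∀ y, Y r y = -if y = b' then 1 else 0) : X.det = Y.det := by
  -- Outside row `r`, column `b` of `Y` is `φ`, so the rank one term disappears. What is left
  -- differs from `X` by an exchange of columns `b` and `b'` and a sign in row `r`, and the two
  -- signs cancel.
  let Y₂ : Matrix ι ι R := Matrix.of fun x y => Y x y + -g y * Y x b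
  have h2 : Y₂.det = Y.det :=
    det_eq_of_forall_col_eq_smul_add_const (fun y => -g y) b (by simp [hg]) fun x y => rfl
  have h3 : ∀ x ≠ r, ∀ y, Y₂ x y = X x y := fun x hx y => by
    simp only [Y₂, Matrix.of_apply]
    rw [h x hx, h x hx, hb x hx, hg]
    ring
  have h4 : ∀ y, Y₂ r y = -if y = b' then 1 else 0 := fun y => by
    simp only [Y₂, Matrix.of_apply]
    rw [hY, hY, if_neg hbb]
    ring
  have hXY : X = Matrix.of fun i j =>
      (if i = r then (-1 : R) else 1) * Y₂.submatrix id (Equiv.swap b b') i j := by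
    ext x y
    simp only [Matrix.of_apply, Matrix.submatrix_apply, id]
    by_cases hx : x = r
    · subst hx
      rw [hX, h4, if_pos rfl]
      have : Equiv.swap b b' y = b' ↔ y = b := by
        rw [← Equiv.eq_symm_apply]
        simp
      simp only [this]
      split_ifs <;> simp
    · rw [if_neg hx, one_mul, h3 x hx]
      by_cases h5 : y = b
      · subst h5; rw [Equiv.swap_apply_left, hb x hx, hb' x hx]
      · by_cases h6 : y = b'
        · subst h6; rw [Equiv.swap_apply_right, hb x hx, hb' x hx]
        · rw [Equiv.swap_apply_of_ne_of_ne h5 h6]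
  rw [← h2, hXY, Matrix.det_mul_column, Matrix.det_permute', Equiv.Perm.sign_swap hbb]
  simp [Finset.prod_ite_eq']

end RankOne

/-! ### The cell matrix of a set of cells with prescribed directions -/

section CellMatrix

/-- The content of a cell, with shift `K`. -/
def cellContent (K : ℤ) (x : ℕ × ℕ) : ℤ := (x.2 : ℤ) - x.1 + K

/-- The cell `y` precedes the cell `x` in its ribbon: it is the cell below `x` if the content of `x`
belongs to `W`, and the cell to the left of `x` otherwise. -/
def Precedes (K : ℤ) (W : ℤ → Prop) (x y : ℕ × ℕ) : Prop :=
  if W (cellContent K x) then y.1 = x.1 + 1 ∧ y.2 = x.2 else y.1 = x.1 ∧ y.2 + 1 = x.2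

/-- The matrix indexed by cells whose row `x` is `-δ_y` if `x` is preceded by the cell `y`, and
consists of ribbon functions otherwise. -/
def cellMatrix {R : Type*} [CommRing R] (S : Finset (ℕ × ℕ)) (K : ℤ) (M : ℤ → ℤ → R)
    (W : ℤ → Prop) : Matrix S S R :=
  Matrix.of fun x y =>
    if ∃ b ∈ S, Precedes K W x b then (if Precedes K W x y then -1 else 0)
    else ribbonKernel M W (cellContent K x) (cellContent K y + 1)

theorem Precedes.content {K : ℤ} {W : ℤ → Prop} {x y : ℕ × ℕ} (h : Precedes K W x y) :
    cellContent K y = cellContent K x - 1 := by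
  unfold Precedes at h
  unfold cellContent
  split_ifs at h <;> omega

variable {S : Finset (ℕ × ℕ)} {K : ℤ}

/-- The cells of content `w` and of content `w - 1` in a convex set of cells. -/
theorem exists_diagonal (hS : ∀ x ∈ S, ∀ z ∈ S, ∀ y, x ≤ y → y ≤ z → y ∈ S) {w : ℤ}
    (hw : ∃ a ∈ S, cellContent K a = w) :
    ∃ i₀ j₀ m : ℕ, (j₀ : ℤ) - i₀ + K = w ∧ (∀ k ≤ m, (i₀ + k, j₀ + k) ∈ S) ∧
      (∀ k < m, (i₀ + k + 1, j₀ + k) ∈ S) ∧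
      (∀ x ∈ S, cellContent K x = w → ∃ k ≤ m, x = (i₀ + k, j₀ + k)) ∧
      (∀ y ∈ S, cellContent K y = w - 1 → ∃ k ≤ m + 1, y.1 = i₀ + k ∧ y.2 + 1 = j₀ + k) := by
  obtain ⟨a, ha, haw⟩ := hw
  have hne : (S.filter fun x => cellContent K x = w).Nonempty := ⟨a, by simp [ha, haw]⟩
  obtain ⟨a₀, ha₀, hmin⟩ := Finset.exists_min_image _ Prod.fst hne
  obtain ⟨a₁, ha₁, hmax⟩ := Finset.exists_max_image _ Prod.fst hne
  have h01 := hmin a₁ ha₁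
  simp only [Finset.mem_filter, and_imp, Prod.forall] at ha₀ ha₁ hmin hmax
  obtain ⟨i₀, j₀⟩ := a₀
  obtain ⟨i₁, j₁⟩ := a₁
  simp only [cellContent] at *
  obtain ⟨ha₀, hc₀⟩ := ha₀
  obtain ⟨ha₁, hc₁⟩ := ha₁
  have hcell : ∀ k ≤ i₁ - i₀, (i₀ + k, j₀ + k) ∈ S := fun k hk =>
    hS _ ha₀ _ ha₁ _ ⟨by simp, by simp⟩ ⟨by simp only; omega, by simp only; omega⟩
  refine ⟨i₀, j₀, i₁ - i₀, hc₀, hcell, ?_, ?_, ?_⟩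
  · intro k hk
    exact hS _ ha₀ _ ha₁ _ ⟨by simp only; omega, by simp only; omega⟩
      ⟨by simp only; omega, by simp only; omega⟩
  · rintro ⟨i, j⟩ hx hxc
    simp only at hxc
    have h1 := hmin i j hx hxc
    have h2 := hmax i j hx hxc
    exact ⟨i - i₀, by omega, by ext <;> simp only <;> omega⟩
  · rintro ⟨i, j⟩ hy hyc
    simp only at hyc ⊢
    -- If a cell of content `w - 1` were above row `i₀`, convexity would put its right neighbour in
    -- `S`, a cell of content `w` above the topmost one. The bound at the other end is symmetric.
    have h1 : i₀ ≤ i := by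
      by_contra hlt
      have h3 : (i, j + 1) ∈ S :=
        hS _ hy _ ha₀ _ ⟨by simp, by simp⟩ ⟨by simp only; omega, by simp only; omega⟩
      have := hmin i (j + 1) h3 (by push_cast; omega)
      omega
    have h2 : i ≤ i₁ + 1 := by
      by_contra hlt
      have h3 : (i - 1, j) ∈ S :=
        hS _ ha₁ _ hy _ ⟨by simp only; omega, by simp only; omega⟩ ⟨by simp, by simp⟩
      have := hmax (i - 1) j h3 (by omega)
      omega
    exact ⟨i - i₀, by omega, by omega, by omega⟩

variable {R : Type*} [CommRing R] (M : ℤ → ℤ → R) {W W' : ℤ → Prop}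

/-- Changing the direction of all the cells of one content preserves the determinant of the cell
matrix. -/
theorem det_cellMatrix_toggle (hS : ∀ x ∈ S, ∀ z ∈ S, ∀ y, x ≤ y → y ≤ z → y ∈ S) {w : ℤ}
    (hw : ∃ a ∈ S, cellContent K a = w) (hW : ¬ W w) (hW' : ∀ t, W' t ↔ W t ∨ t = w) :
    (cellMatrix S K M W).det = (cellMatrix S K M W').det := by
  obtain ⟨i₀, j₀, m, hij, hA, hmid, hAll, hB⟩ := exists_diagonal hS hw
  set Z := cellMatrix S K M W with hZ
  set Z' := cellMatrix S K M W' with hZ'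
  have hWw' : W' w := (hW' w).2 (Or.inr rfl)
  let ct : S → ℤ := fun x => cellContent K x
  have hct : ∀ x : S, ct x = (x.1.2 : ℤ) - x.1.1 + K := fun x => rfl
  -- Conjugation by signs.
  let ε : S → R := fun x => if w ≤ ct x then -1 else 1
  let Zs : Matrix S S R := Matrix.of fun x y => ε y * (Matrix.of fun x y => ε x * Z x y) x y
  have hZs : Zs.det = Z.det := by
    simp only [Zs]
    rw [Matrix.det_mul_row, Matrix.det_mul_column, ← mul_assoc, ← Finset.prod_mul_distrib]
    rw [Finset.prod_eq_one, one_mul]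
    intro x _
    simp only [ε]
    split_ifs <;> simp
  have hZsa : ∀ x y, Zs x y = ε y * (ε x * Z x y) := fun x y => rfl
  -- the diagonal of content `w`
  let e : ℕ → S := fun k => if h : (i₀ + k, j₀ + k) ∈ S then ⟨_, h⟩ else ⟨_, hA 0 (Nat.zero_le _)⟩
  have he : ∀ k ≤ m, (e k).1 = (i₀ + k, j₀ + k) := fun k hk => by
    simp only [e]
    rw [dif_pos (hA k hk)]
  have heinj : ∀ k ≤ m, ∀ l ≤ m, e k = e l → k = l := fun k hk l hl h => by
    have h1 := congrArg (fun x : S => x.1.1) h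
    simp only [he k hk, he l hl] at h1
    omega
  have hect : ∀ k ≤ m, ct (e k) = w := fun k hk => by
    rw [hct, he k hk]; push_cast; omega
  have hdiag : ∀ x : S, ct x = w → ∃ k ≤ m, x = e k := fun x hx => by
    obtain ⟨k, hk, h⟩ := hAll x.1 x.2 hx
    exact ⟨k, hk, Subtype.ext (by rw [h, he k hk])⟩
  let Below : S → S → Prop := fun x y => y.1.1 = x.1.1 + 1 ∧ y.1.2 = x.1.2
  let Mid : S → Prop := fun y => ∃ k < m, y.1.1 = i₀ + k + 1 ∧ y.1.2 = j₀ + k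
  let h : S → R := fun y => Zs (e 0) y
  let h' : S → R := fun y => Z' (e m) y
  -- `φ` and `g` are the two factors of the product rule for cutting at `w`; they form the rank one
  -- correction.
  let g : S → R := fun y => if w ≤ ct y then ribbonKernel M W w (ct y + 1) else 0
  let φ : S → R := fun x =>
    if (∃ b ∈ S, Precedes K W x b) ∨ w ≤ ct x then 0 else ribbonKernel M W (ct x) w
  -- The left neighbour of `e (k + 1)` is the cell below `e k`, so the old unit rows become the new
  -- ones after a shift by one and a change of sign.
  have hrow : ∀ k < m, ∀ y, Zs (e (k + 1)) y = if Below (e k) y then 1 else 0 := by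
    intro k hk y
    have h1 := hect (k + 1) (by omega)
    have hp : ∀ y : ℕ × ℕ, Precedes K W (e (k + 1)) y ↔ y.1 = i₀ + k + 1 ∧ y.2 = j₀ + k := by
      intro y
      have h2 : ¬ W (cellContent K (e (k + 1))) := by
        change ¬ W (ct _)
        rwa [h1]
      rw [Precedes, if_neg h2, he _ (by omega)]
      constructor <;> rintro ⟨h, h'⟩ <;> constructor <;> omega
    have hb : Below (e k) y ↔ y.1.1 = i₀ + k + 1 ∧ y.1.2 = j₀ + k := by
      simp only [Below, he k hk.le]
    rw [hZsa, hZ, cellMatrix, Matrix.of_apply, if_pos ⟨_, hmid k hk, (hp _).2 ⟨rfl, rfl⟩⟩]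
    simp only [hp, hb, ε, h1, le_refl, if_true]
    split_ifs with h3 h4
    · have := hct y
      omega
    · simp
    · simp
    · simp
  let Z₁ : Matrix S S R := Matrix.of fun x y =>
    if x = e m then h y else if ct x = w then (if Below x y then -1 else 0) else Zs x y
  have hne : ∀ k < m, e k ≠ e m := fun k hk h => by
    have := heinj k hk.le m le_rfl h
    omega
  have hZ₁ : Z₁.det = Zs.det := by
    refine det_slide e m heinj ?_ ?_ ?_
    · intro k hk y
      simp only [Z₁, Matrix.of_apply]
      rw [if_neg (hne k hk), if_pos (hect k hk.le), hrow k hk]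
      split_ifs <;> simp
    · intro y
      simp only [Z₁, Matrix.of_apply, if_true, h]
    · intro x hx y
      simp only [Z₁, Matrix.of_apply]
      rw [if_neg (hx m le_rfl), if_neg]
      intro hxw
      obtain ⟨k, hk, h⟩ := hdiag x hxw
      exact hx k hk h
  -- clearing the middle part of the diagonal of content `w - 1`
  let S₀ : Finset S := Finset.univ.filter fun x => ct x = w ∧ x ≠ e m
  have hS₀ : ∀ x, x ∈ S₀ ↔ ∃ k < m, x = e k := fun x => by
    simp only [S₀, Finset.mem_filter, Finset.mem_univ, true_and]
    constructor
    · rintro ⟨h1, h2⟩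
      obtain ⟨k, hk, rfl⟩ := hdiag x h1
      exact ⟨k, lt_of_le_of_ne hk fun h => h2 (by rw [h]), rfl⟩
    · rintro ⟨k, hk, rfl⟩
      exact ⟨hect k hk.le, hne k hk⟩
  let bl : S → S := fun x => if h : (x.1.1 + 1, x.1.2) ∈ S then ⟨_, h⟩ else x
  have hbl : ∀ k < m, (bl (e k)).1 = (i₀ + k + 1, j₀ + k) := fun k hk => by
    have h1 := hmid k hk
    have h2 : ((e k).1.1 + 1, (e k).1.2) = (i₀ + k + 1, j₀ + k) := by rw [he k hk.le]
    simp only [bl]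
    rw [dif_pos (by rw [h2]; exact h1)]
    exact h2
  have hblB : ∀ k < m, ∀ y, y = bl (e k) ↔ Below (e k) y := fun k hk y => by
    rw [Subtype.ext_iff, hbl k hk]
    simp only [Below, he k hk.le, Prod.ext_iff]
  -- The unit rows shared by both matrices clear every column of content `w - 1` except those of the
  -- at most two end cells of that diagonal.
  have clear : ∀ A : Matrix S S R,
      (∀ k < m, ∀ y, A (e k) y = if Below (e k) y then -1 else 0) →
      (Matrix.of fun x y => if x ∈ S₀ then A x y else if Mid y then 0 else A x y).det = A.det := by
    intro A hAr
    refine det_clear_columns S₀ bl ?_ ?_ ?_ ?_ ?_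
    · intro x hx y
      obtain ⟨k, hk, rfl⟩ := (hS₀ x).1 hx
      rw [hAr k hk]
      simp only [hblB k hk]
    · intro x hx y
      simp [hx]
    · intro x hx x' hx' hxx
      obtain ⟨k, hk, rfl⟩ := (hS₀ x).1 hx
      obtain ⟨k', hk', rfl⟩ := (hS₀ x').1 hx'
      have h1 := congrArg Subtype.val hxx
      rw [hbl k hk, hbl k' hk', Prod.ext_iff] at h1
      simp only at h1
      rw [show k = k' by omega]
    · intro x hx r hr
      obtain ⟨k, hk, rfl⟩ := (hS₀ r).1 hr
      simp only [Matrix.of_apply, if_neg hx]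
      rw [if_pos]
      exact ⟨k, hk, by rw [hbl k hk], by rw [hbl k hk]⟩
    · intro x hx y hy
      simp only [Matrix.of_apply, if_neg hx]
      rw [if_neg]
      rintro ⟨k, hk, h1, h2⟩
      refine hy (e k) ((hS₀ _).2 ⟨k, hk, rfl⟩) (Subtype.ext ?_)
      rw [hbl k hk]
      exact Prod.ext h1 h2
  have hX := clear Z₁ (fun k hk y => by
    simp only [Z₁, Matrix.of_apply]
    rw [if_neg (hne k hk), if_pos (hect k hk.le)])
  have hrow' : ∀ k < m, ∀ y, Z' (e k) y = if Below (e k) y then -1 else 0 := by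
    intro k hk y
    have h1 := hect k hk.le
    have hp : ∀ y : ℕ × ℕ, Precedes K W' (e k) y ↔ y.1 = (e k).1.1 + 1 ∧ y.2 = (e k).1.2 := by
      intro y
      have h2 : W' (cellContent K (e k)) := by
        change W' (ct _)
        rwa [h1]
      rw [Precedes, if_pos h2]
    rw [hZ', cellMatrix, Matrix.of_apply, if_pos ⟨_, hmid k hk, (hp _).2 (by rw [he k hk.le]; simp)⟩]
    simp only [hp, Below]
  have hY := clear Z' hrow'
  rw [← hZs, ← hZ₁, ← hX, ← hY]
  -- the remaining entries
  have hgB : ∀ y, ct y = w - 1 → g y = 0 := fun y hy => by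
    simp only [g]
    rw [if_neg (by omega)]
  have hφm : φ (e m) = 0 := by
    simp only [φ]
    rw [if_pos (Or.inr (hect m le_rfl).ge)]
  have hprec : ∀ x : S, ct x ≠ w → ∀ y, Precedes K W' x y ↔ Precedes K W x y := fun x hx y => by
    have : W' (cellContent K x) ↔ W (cellContent K x) := by
      rw [hW']
      exact ⟨fun h => h.resolve_right hx, Or.inl⟩
    simp only [Precedes, this]
  -- The conjugation reverses the sign exactly when `w` separates the contents of `x` and `y`. This
  -- absorbs the minus sign in `ribbonKernel_toggle`.
  have hsame : ∀ x, ct x ≠ w → ∀ y, Z' x y = Zs x y + φ x * g y := by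
    intro x hx y
    rw [hZsa, hZ, hZ', cellMatrix, cellMatrix, Matrix.of_apply, Matrix.of_apply]
    simp only [hprec x hx, φ]
    by_cases hl : ∃ b ∈ S, Precedes K W x b
    · rw [if_pos hl, if_pos hl, if_pos (Or.inl hl)]
      split_ifs with h1
      · have h2 := h1.content
        have h3 : (w ≤ ct x) ↔ (w ≤ ct y) := by
          change ct y = ct x - 1 at h2
          omega
        simp only [ε, h3]
        split_ifs <;> simp
      · simp
    · rw [if_neg hl, if_neg hl]
      simp only [hl, false_or]
      change ribbonKernel M W' (ct x) (ct y + 1)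
        = ε y * (ε x * ribbonKernel M W (ct x) (ct y + 1)) + _
      have hcongr : ct y < w ∨ w < ct x →
          ribbonKernel M W' (ct x) (ct y + 1) = ribbonKernel M W (ct x) (ct y + 1) := fun hc =>
        ribbonKernel_congr M W' W fun t h1 h2 => by
          rw [hW']
          exact ⟨fun h => h.resolve_right (by omega), Or.inl⟩
      rcases lt_or_gt_of_ne hx with hx | hx
      · rcases lt_or_ge (ct y) w with hy | hy
        · rw [hcongr (Or.inl hy)]
          simp only [g, ε]
          rw [if_neg (not_le.2 hy), if_neg (not_le.2 hx), if_neg (not_le.2 hy)]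
          simp
        · rw [ribbonKernel_toggle M W W' hx (by omega) hW hW']
          simp only [g, ε]
          rw [if_pos hy, if_neg (not_le.2 hx), if_neg (not_le.2 hx), if_pos hy]
          ring
      · rw [hcongr (Or.inr hx), if_pos hx.le]
        simp only [ε, if_pos hx.le]
        rcases lt_or_ge (ct y) w with hy | hy
        · rw [ribbonKernel_of_lt M W (by omega)]
          simp
        · rw [if_pos hy]
          simp
  have hZsB : ∀ x, ct x ≠ w → ∀ y, ct y = w - 1 → Zs x y = φ x := by
    intro x hx y hy
    rw [hZsa, hZ, cellMatrix, Matrix.of_apply]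
    simp only [φ]
    by_cases hl : ∃ b ∈ S, Precedes K W x b
    · rw [if_pos hl, if_pos (Or.inl hl), if_neg]
      · simp
      · intro h1
        have h2 := h1.content
        change ct y = ct x - 1 at h2
        omega
    · rw [if_neg hl]
      simp only [hl, false_or]
      change ε y * (ε x * ribbonKernel M W (ct x) (ct y + 1)) = _
      rw [hy, sub_add_cancel]
      simp only [ε]
      split_ifs with h1 h2 h3
      · omega
      · omega
      · rw [ribbonKernel_of_lt M W (by omega)]
        simp
      · simp
  have hmS₀ : e m ∉ S₀ := by simp [S₀]
  have hφS₀ : ∀ x ∈ S₀, φ x = 0 := fun x hx => by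
    obtain ⟨k, hk, rfl⟩ := (hS₀ x).1 hx
    simp only [φ]
    rw [if_pos (Or.inr (hect k hk.le).ge)]
  have hMidct : ∀ y, Mid y → ct y = w - 1 := fun y => by
    rintro ⟨k, hk, h1, h2⟩
    rw [hct, h1, h2]; push_cast; omega
  have hw_of : ∀ x, x ∉ S₀ → x ≠ e m → ct x ≠ w := fun x h1 h2 h3 => h1 (by simp [S₀, h2, h3])
  have hdiff : ∀ x ≠ e m, ∀ y,
      (Matrix.of fun x y => if x ∈ S₀ then Z' x y else if Mid y then 0 else Z' x y) x y =
      (Matrix.of fun x y => if x ∈ S₀ then Z₁ x y else if Mid y then 0 else Z₁ x y) x y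
        + φ x * g y := by
    intro x hx y
    simp only [Matrix.of_apply]
    by_cases hxS : x ∈ S₀
    · rw [if_pos hxS, if_pos hxS, hφS₀ x hxS]
      obtain ⟨k, hk, rfl⟩ := (hS₀ x).1 hxS
      rw [hrow' k hk]
      simp only [Z₁, Matrix.of_apply]
      rw [if_neg hx, if_pos (hect k hk.le)]
      ring
    · rw [if_neg hxS, if_neg hxS]
      split_ifs with hy
      · rw [hgB y (hMidct y hy)]; ring
      · rw [hsame x (hw_of x hxS hx)]
        simp only [Z₁, Matrix.of_apply]
        rw [if_neg hx, if_neg (hw_of x hxS hx)]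
  have hend : ∀ b, ct b = w - 1 → ¬ Mid b → ∀ x ≠ e m,
      (Matrix.of fun x y => if x ∈ S₀ then Z₁ x y else if Mid y then 0 else Z₁ x y) x b = φ x := by
    intro b hb hbm x hx
    simp only [Matrix.of_apply]
    by_cases hxS : x ∈ S₀
    · rw [if_pos hxS, hφS₀ x hxS]
      obtain ⟨k, hk, rfl⟩ := (hS₀ x).1 hxS
      simp only [Z₁, Matrix.of_apply]
      rw [if_neg hx, if_pos (hect k hk.le), if_neg]
      rintro ⟨h1, h2⟩
      refine hbm ⟨k, hk, ?_, ?_⟩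
      · rw [h1, he k hk.le]
      · rw [h2, he k hk.le]
    · rw [if_neg hxS, if_neg hbm]
      simp only [Z₁, Matrix.of_apply]
      rw [if_neg hx, if_neg (hw_of x hxS hx), hZsB x (hw_of x hxS hx) b hb]
  have hXm : ∀ y, (Matrix.of fun x y => if x ∈ S₀ then Z₁ x y else if Mid y then 0 else Z₁ x y)
      (e m) y = if Mid y then 0 else h y := fun y => by
    simp only [Matrix.of_apply, if_neg hmS₀, Z₁, if_true]
  have hYm : ∀ y, (Matrix.of fun x y => if x ∈ S₀ then Z' x y else if Mid y then 0 else Z' x y)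
      (e m) y = if Mid y then 0 else h' y := fun y => by
    simp only [Matrix.of_apply, if_neg hmS₀, h']
  have hcases : ∀ y, ct y = w - 1 → ¬ Mid y →
      (y.1.1 = i₀ ∧ y.1.2 + 1 = j₀) ∨ (y.1.1 = i₀ + m + 1 ∧ y.1.2 = j₀ + m) := by
    intro y hy hym
    obtain ⟨k, hk, h1, h2⟩ := hB y.1 y.2 hy
    -- `k = 0` is the cell to the left of the top cell, `k = m + 1` the cell below the bottom cell;
    -- all other positions satisfy `Mid`.
    rcases Nat.eq_zero_or_pos k with hk0 | hk0
    · left; omega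
    · right
      by_contra hc
      exact hym ⟨k - 1, by omega, by omega, by omega⟩
  -- the row of the top cell
  have hP0 : ∀ y : ℕ × ℕ, Precedes K W (e 0) y ↔ y.1 = i₀ ∧ y.2 + 1 = j₀ := by
    intro y
    have h2 : ¬ W (cellContent K (e 0)) := by
      change ¬ W (ct _)
      rwa [hect 0 (Nat.zero_le _)]
    rw [Precedes, if_neg h2, he _ (Nat.zero_le _)]
    simp
  have hPm : ∀ y : ℕ × ℕ, Precedes K W' (e m) y ↔ y.1 = i₀ + m + 1 ∧ y.2 = j₀ + m := by
    intro y
    have h2 : W' (cellContent K (e m)) := by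
      change W' (ct _)
      rwa [hect m le_rfl]
    rw [Precedes, if_pos h2, he _ le_rfl]
  have htop : ∀ b : S, b.1.1 = i₀ → b.1.2 + 1 = j₀ →
      ∀ y, h y = if y = b then 1 else 0 := by
    intro b hb1 hb2 y
    have h1 : y = b ↔ y.1.1 = i₀ ∧ y.1.2 + 1 = j₀ := by
      rw [Subtype.ext_iff, Prod.ext_iff, hb1, ← hb2]
      simp
    simp only [h]
    rw [hZsa, hZ, cellMatrix, Matrix.of_apply, if_pos ⟨b.1, b.2, (hP0 _).2 ⟨hb1, hb2⟩⟩]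
    simp only [hP0, h1, ε, hect 0 (Nat.zero_le _), le_refl, if_true]
    split_ifs with h3 h4
    · have := hct y
      omega
    all_goals simp
  -- Here the top cell starts a chain. In a column of content `w - 1` its ribbon is empty, hence the
  -- kernel is `1` there, with a sign from the conjugation.
  have htop' : (¬ ∃ b : S, b.1.1 = i₀ ∧ b.1.2 + 1 = j₀) →
      ∀ y, h y = if ct y = w - 1 then -1 else g y := by
    intro hb y
    simp only [h]
    rw [hZsa, hZ, cellMatrix, Matrix.of_apply, if_neg]
    · change ε y * (ε (e 0) * ribbonKernel M W (ct (e 0)) (ct y + 1)) = _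
      rw [hect 0 (Nat.zero_le _)]
      simp only [ε, g, hect 0 (Nat.zero_le _), le_refl, if_true]
      split_ifs with h1 h2 h2
      · omega
      · simp
      · rw [h2, sub_add_cancel, ribbonKernel_self]; simp
      · rw [ribbonKernel_of_lt M W (by omega)]; simp
    · rintro ⟨b, hb1, hb2⟩
      exact hb ⟨⟨b, hb1⟩, (hP0 b).1 hb2⟩
  have hbot : ∀ b : S, b.1.1 = i₀ + m + 1 → b.1.2 = j₀ + m →
      ∀ y, h' y = -if y = b then 1 else 0 := by
    intro b hb1 hb2 y
    have h1 : y = b ↔ y.1.1 = i₀ + m + 1 ∧ y.1.2 = j₀ + m := by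
      rw [Subtype.ext_iff, Prod.ext_iff, hb1, ← hb2]
    simp only [h']
    rw [hZ', cellMatrix, Matrix.of_apply, if_pos ⟨b.1, b.2, (hPm _).2 ⟨hb1, hb2⟩⟩]
    simp only [hPm, h1]
    split_ifs <;> simp
  have hbot' : (¬ ∃ b : S, b.1.1 = i₀ + m + 1 ∧ b.1.2 = j₀ + m) →
      ∀ y, h' y = if ct y = w - 1 then 1 else g y := by
    intro hb y
    simp only [h']
    rw [hZ', cellMatrix, Matrix.of_apply, if_neg]
    · change ribbonKernel M W' (ct (e m)) (ct y + 1) = _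
      rw [hect m le_rfl, ribbonKernel_congr M W' W fun t h1 h2 => by
        rw [hW']
        exact ⟨fun h => h.resolve_right (by omega), Or.inl⟩]
      simp only [g]
      split_ifs with h1 h2
      · rw [h1, sub_add_cancel, ribbonKernel_self]
      · rfl
      · rw [ribbonKernel_of_lt M W (by omega)]
    · rintro ⟨b, hb1, hb2⟩
      exact hb ⟨⟨b, hb1⟩, (hPm b).1 hb2⟩
  have hmt : ∀ b : S, b.1.1 = i₀ → b.1.2 + 1 = j₀ → ct b = w - 1 ∧ ¬ Mid b := by
    intro b h1 h2
    refine ⟨by rw [hct]; omega, ?_⟩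
    rintro ⟨k, hk, h3, h4⟩
    omega
  have hmb : ∀ b : S, b.1.1 = i₀ + m + 1 → b.1.2 = j₀ + m → ct b = w - 1 ∧ ¬ Mid b := by
    intro b h1 h2
    refine ⟨by rw [hct]; omega, ?_⟩
    rintro ⟨k, hk, h3, h4⟩
    omega
  -- Four cases: each end cell of the diagonal `w - 1` may be present or absent.
  by_cases ht : ∃ b : S, b.1.1 = i₀ ∧ b.1.2 + 1 = j₀
  · obtain ⟨b, hb1, hb2⟩ := ht
    obtain ⟨hbw, hbm⟩ := hmt b hb1 hb2
    have hXb : ∀ y, (if Mid y then 0 else h y) = if y = b then (1 : R) else 0 := fun y => by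
      rw [htop b hb1 hb2]
      split_ifs with h1 h2
      · exact (hbm (h2 ▸ h1)).elim
      all_goals rfl
    by_cases hd : ∃ b : S, b.1.1 = i₀ + m + 1 ∧ b.1.2 = j₀ + m
    · obtain ⟨b', hb1', hb2'⟩ := hd
      obtain ⟨hbw', hbm'⟩ := hmb b' hb1' hb2'
      refine det_eq_of_row_single (r := e m) (b := b) (b' := b') ?_ hdiff (hgB b hbw)
        (hgB b' hbw') (hend b hbw hbm) (hend b' hbw' hbm') ?_ ?_
      · rintro rfl; omega
      · exact fun y => (hXm y).trans (hXb y)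
      · intro y
        rw [hYm, hbot b' hb1' hb2']
        split_ifs with h1 h2
        · exact (hbm' (h2 ▸ h1)).elim
        all_goals simp
    · refine det_eq_of_row_add_single (r := e m) (b := b) hφm hdiff (hgB b hbw)
        (hend b hbw hbm) (fun y => (hXm y).trans (hXb y)) ?_
      intro y
      rw [hYm, hbot' hd]
      by_cases hyw : ct y = w - 1
      · rw [hgB y hyw, if_pos hyw]
        by_cases hym : Mid y
        · rw [if_pos hym, if_neg (show ¬ y = b from fun h => hbm (h ▸ hym))]; simp
        · have : y = b := by
            rcases hcases y hyw hym with h1 | h1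
            · exact Subtype.ext (Prod.ext (by omega) (by omega))
            · exact (hd ⟨y, h1⟩).elim
          rw [if_neg hym, if_pos this]; simp
      · rw [if_neg hyw, if_neg (fun h => hyw (hMidct y h)),
          if_neg (show ¬ y = b from fun h => hyw (h ▸ hbw))]
        simp
  · have hh := htop' ht
    by_cases hd : ∃ b : S, b.1.1 = i₀ + m + 1 ∧ b.1.2 = j₀ + m
    · obtain ⟨b, hb1, hb2⟩ := hd
      obtain ⟨hbw, hbm⟩ := hmb b hb1 hb2
      refine det_eq_of_row_sub_single (r := e m) (b := b) hφm hdiff (hgB b hbw)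
        (hend b hbw hbm) ?_ ?_
      · intro y
        rw [hXm, hh]
        by_cases hyw : ct y = w - 1
        · rw [hgB y hyw, if_pos hyw]
          by_cases hym : Mid y
          · rw [if_pos hym, if_neg (show ¬ y = b from fun h => hbm (h ▸ hym))]; simp
          · have : y = b := by
              rcases hcases y hyw hym with h1 | h1
              · exact (ht ⟨y, h1⟩).elim
              · exact Subtype.ext (Prod.ext (by omega) (by omega))
            rw [if_neg hym, if_pos this]; simp
        · rw [if_neg hyw, if_neg (fun h => hyw (hMidct y h)),
          if_neg (show ¬ y = b from fun h => hyw (h ▸ hbw))]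
          simp
      · intro y
        rw [hYm, hbot b hb1 hb2]
        split_ifs with h1 h2
        · exact (hbm (h2 ▸ h1)).elim
        all_goals simp
    · have hno : ∀ y, ct y = w - 1 → Mid y := fun y hy => by
        by_contra hym
        rcases hcases y hy hym with h1 | h1
        · exact ht ⟨y, h1⟩
        · exact hd ⟨y, h1⟩
      have hz : ∀ (c : R) (y : S),
          (if Mid y then 0 else if ct y = w - 1 then c else g y) = g y := fun c y => by
        split_ifs with h1 h2
        · rw [hgB y (hMidct y h1)]
        · exact (h1 (hno y h2)).elim
        · rfl
      refine det_eq_of_row_eq (r := e m) hφm hdiff ?_ ?_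
      · intro y
        rw [hXm, hh, hz]
      · intro y
        rw [hYm, hbot' hd, hz]

end CellMatrix

/-! ### Connected sets of cells -/

/-- In a connected set of cells, a property that holds for one cell and fails for another one is
lost along some edge. -/
theorem CellsConnected.exists_boundary {T : Finset (ℕ × ℕ)} (hT : CellsConnected T)
    (f : ℕ × ℕ → Prop) {x y : ℕ × ℕ} (hx : x ∈ T) (hy : y ∈ T) (hfx : f x) (hfy : ¬ f y) :
    ∃ u ∈ T, ∃ v ∈ T, f u ∧ ¬ f v ∧
      (((u.1 + 1 = v.1 ∧ u.2 = v.2) ∨ (u.1 = v.1 ∧ u.2 + 1 = v.2)) ∨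
        ((v.1 + 1 = u.1 ∧ v.2 = u.2) ∨ (v.1 = u.1 ∧ v.2 + 1 = u.2))) := by
  obtain ⟨p⟩ := hT ⟨x, hx⟩ ⟨y, hy⟩
  obtain ⟨d, -, h1, h2⟩ := p.exists_boundary_dart {u | f u.1} hfx hfy
  refine ⟨d.fst.1, d.fst.2, d.snd.1, d.snd.2, h1, h2, ?_⟩
  have h3 := d.adj
  simp only [SimpleGraph.comap_adj, cellGraph, SimpleGraph.fromRel_adj] at h3
  exact h3.2

/-- The contents of a connected set of cells form an interval. -/
theorem CellsConnected.exists_content {T : Finset (ℕ × ℕ)} (hT : CellsConnected T) (K : ℤ)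
    {x y : ℕ × ℕ} (hx : x ∈ T) (hy : y ∈ T) {t : ℤ} (h1 : cellContent K x ≤ t)
    (h2 : t ≤ cellContent K y) : ∃ a ∈ T, cellContent K a = t := by
  by_contra hno
  push Not at hno
  obtain ⟨u, hu, v, hv, h3, h4, h5⟩ := hT.exists_boundary (fun a => cellContent K a ≤ t) hx hy h1
    (fun h => hno y hy (le_antisymm h h2))
  have := hno u hu
  simp only [cellContent] at *
  omega

/-! ### Independence of the cell determinant from the directions. -/

section Invariance

variable {R : Type*} [CommRing R]

/-- A kernel sees only breaks strictly between its ends, and these are contents of `S` because the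
contents form an interval. -/
theorem cellMatrix_congr {S : Finset (ℕ × ℕ)} {K : ℤ} (M : ℤ → ℤ → R) {W W' : ℤ → Prop}
    (hS : ∀ x ∈ S, ∀ y ∈ S, ∀ t, cellContent K x ≤ t → t ≤ cellContent K y →
      ∃ a ∈ S, cellContent K a = t)
    (h : ∀ a ∈ S, (W (cellContent K a) ↔ W' (cellContent K a))) :
    cellMatrix S K M W = cellMatrix S K M W' := by
  ext x y
  have h1 : ∀ b, Precedes K W x b ↔ Precedes K W' x b := fun b => by
    simp only [Precedes, h x x.2]
  simp only [cellMatrix, Matrix.of_apply, h1]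
  rw [ribbonKernel_congr M W W']
  intro t h2 h3
  obtain ⟨a, ha, rfl⟩ := hS x x.2 y y.2 t h2.le (by omega)
  exact h a ha

/-- The determinant of the cell matrix does not depend on the directions. -/
theorem det_cellMatrix_eq {S : Finset (ℕ × ℕ)} {K : ℤ} (M : ℤ → ℤ → R)
    (hconv : ∀ x ∈ S, ∀ z ∈ S, ∀ y, x ≤ y → y ≤ z → y ∈ S) (hconn : CellsConnected S)
    (W : ℤ → Prop) :
    (cellMatrix S K M W).det = (cellMatrix S K M fun _ => False).det := by
  have key : ∀ T : Finset ℤ, (∀ t ∈ T, ∃ a ∈ S, cellContent K a = t) →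
      (cellMatrix S K M fun t => t ∈ T).det = (cellMatrix S K M fun _ => False).det := by
    intro T
    induction T using Finset.induction_on with
    | empty => intro _; simp
    | insert t T ht ih =>
      intro h
      rw [← ih fun t ht => h t (Finset.mem_insert_of_mem ht)]
      symm
      refine det_cellMatrix_toggle M hconv (h t (Finset.mem_insert_self _ _)) ht fun u => ?_
      rw [Finset.mem_insert, or_comm]
  -- Only the finitely many contents that occur in `S` matter, so `W` may be replaced by a finite
  -- set.
  rw [← key ((S.image (cellContent K)).filter W)]
  · rw [cellMatrix_congr M fun x hx y hy t => hconn.exists_content K hx hy]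
    intro a ha
    simp only [Finset.mem_filter, Finset.mem_image]
    exact ⟨fun h => ⟨⟨a, ha, rfl⟩, h⟩, fun h => h.2⟩
  · intro t ht
    simpa using (Finset.mem_filter.1 ht).1

end Invariance

/-! ### Ribbon determinants -/

section Hessenberg

variable {R : Type*} [CommRing R]

/-- The Jacobi-Trudi determinant of a ribbon is the ribbon kernel. Here `x i` is one more than the
content of the last cell, and `x (i + 1)` is the content of the first cell, of row `i`. -/
theorem det_ribbon (M : ℤ → ℤ → R) (hM₁ : ∀ p, M p p = 1) (hM₀ : ∀ p q, q < p → M p q = 0)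
    (m : ℕ) (x : ℕ → ℤ) (W : ℤ → Prop) (hx : ∀ i ≤ m, x (i + 1) < x i)
    (hW : ∀ t, x (m + 1) < t → t < x 0 → (W t ↔ ∃ i, 1 ≤ i ∧ i ≤ m ∧ t = x i)) :
    Matrix.det (Matrix.of fun i j : Fin (m + 1) => M (x (j + 1)) (x i)) =
      ribbonKernel M W (x (m + 1)) (x 0) := by
  induction m generalizing x W with
  | zero =>
    rw [Matrix.det_fin_one, ribbonKernel_of_forall_not M W (hx 0 le_rfl)]
    · simp
    · intro t h1 h2 h3
      obtain ⟨i, h4, h5, -⟩ := (hW t h1 h2).1 h3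
      omega
  | succ m ih =>
    have hanti : ∀ i j, i ≤ j → j ≤ m + 2 → x j ≤ x i := by
      intro i j hij
      induction j, hij using Nat.le_induction with
      | base => exact fun _ => le_rfl
      | succ j hj ih => exact fun h => (hx j (by omega)).le.trans (ih (by omega))
    have hanti' : ∀ i j, i < j → j ≤ m + 2 → x j < x i := fun i j hij hj =>
      (hanti (i + 1) j hij hj).trans_lt (hx i (by omega))
    -- The break between the two top rows is dropped. `x₁` describes the ribbon without row `0`, and
    -- `x₂` the ribbon in which rows `0` and `1` are merged. They give the two nonzero minors in the
    -- expansion along the first column, whose entries are `M (x 1) (x 0)`, `1`, and then zeros.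
    let W₀ : ℤ → Prop := fun t => W t ∧ t ≠ x 1
    let x₁ : ℕ → ℤ := fun i => x (i + 1)
    let x₂ : ℕ → ℤ := fun i => if i = 0 then x 0 else x (i + 1)
    have hW1 : W (x 1) :=
      (hW (x 1) (hanti' 1 (m + 2) (by omega) le_rfl) (hx 0 (by omega))).2
        ⟨1, le_rfl, by omega, rfl⟩
    have e1 := ih x₁ W₀ (fun i hi => hx (i + 1) (by omega)) (by
      intro t h1 h2
      simp only [x₁, zero_add] at h1 h2 ⊢
      simp only [W₀]
      rw [hW t h1 (h2.trans (hx 0 (by omega)))]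
      constructor
      · rintro ⟨⟨i, h3, h4, rfl⟩, h5⟩
        have : i ≠ 1 := fun h => h5 (by rw [h])
        exact ⟨i - 1, by omega, by omega, by rw [Nat.sub_add_cancel h3]⟩
      · rintro ⟨i, h3, h4, rfl⟩
        exact ⟨⟨i + 1, by omega, by omega, rfl⟩, by omega⟩)
    have e2 := ih x₂ W₀ (fun i hi => by
        simp only [x₂]
        rw [if_neg (by omega)]
        split_ifs with h
        · subst h; exact hanti' 0 2 (by omega) (by omega)
        · exact hx (i + 1) (by omega)) (by
      intro t h1 h2
      simp only [x₂] at h1 h2 ⊢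
      rw [if_neg (by omega)] at h1
      simp only [if_true] at h2
      simp only [W₀]
      rw [hW t h1 h2]
      constructor
      · rintro ⟨⟨i, h3, h4, rfl⟩, h5⟩
        have : i ≠ 1 := fun h => h5 (by rw [h])
        exact ⟨i - 1, by omega, by omega, by
          rw [if_neg (by omega), Nat.sub_add_cancel h3]⟩
      · rintro ⟨i, h3, h4, h5⟩
        rw [if_neg (by omega)] at h5
        subst h5
        exact ⟨⟨i + 1, by omega, by omega, rfl⟩, (hanti' 1 (i + 1) (by omega) (by omega)).ne⟩)
    have e3 := ribbonKernel_toggle M W₀ W (w := x 1) (p := x (m + 2)) (q := x 0)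
      (hanti' 1 (m + 2) (by omega) le_rfl) (hx 0 (by omega)) (fun h => h.2 rfl) (fun t => by
        simp only [W₀]
        constructor
        · intro h
          by_cases ht : t = x 1
          · exact Or.inr ht
          · exact Or.inl ⟨h, ht⟩
        · rintro (h | rfl)
          · exact h.1
          · exact hW1)
    have e4 : ribbonKernel M W₀ (x 1) (x 0) = M (x 1) (x 0) := by
      refine ribbonKernel_of_forall_not M W₀ (hx 0 (by omega)) fun t h1 h2 h3 => ?_
      obtain ⟨i, h4, h5, rfl⟩ :=
        (hW t ((hanti' 1 (m + 2) (by omega) le_rfl).trans h1) h2).1 h3.1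
      have := hanti 1 i h4 (by omega)
      omega
    rw [show m + 1 + 1 = m + 2 from rfl, e3, e4]
    simp only [x₁, x₂, zero_add, if_true] at e1 e2
    rw [if_neg (by omega)] at e2
    rw [← e1, ← e2, Matrix.det_succ_column_zero, Fin.sum_univ_succ, Fin.sum_univ_succ,
      Finset.sum_eq_zero, add_zero]
    · have d1 : (Matrix.of fun i j : Fin (m + 2) => M (x (j + 1)) (x i)).submatrix
          (Fin.succAbove 0) Fin.succ =
          Matrix.of fun i j : Fin (m + 1) => M (x (j + 1 + 1)) (x (i + 1)) := by
        ext i j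
        simp
      have d2 : (Matrix.of fun i j : Fin (m + 2) => M (x (j + 1)) (x i)).submatrix
          (Fin.succAbove (Fin.succ 0)) Fin.succ =
          Matrix.of fun i j : Fin (m + 1) => M (if (j : ℕ) + 1 = 0 then x 0 else x (j + 1 + 1))
            (if (i : ℕ) = 0 then x 0 else x (i + 1)) := by
        ext i j
        refine Fin.cases ?_ (fun i => ?_) i
        · simp
        · simp [Fin.succAbove]
      rw [d1, d2]
      simp [hM₁]
      ring
    · intro i _
      simp only [Matrix.of_apply, Fin.val_succ, Fin.val_zero]
      rw [hM₀ _ _ (hanti' _ _ (by omega) (by omega)), mul_zero, zero_mul]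

end Hessenberg

/-! ### Rows of shapes -/

namespace RShape

theorem mem_cells_iff (s : RShape) (i j : ℕ) :
    (i, j) ∈ s.cells ↔ s.inner.rowLen i ≤ j ∧ j < s.outer.rowLen i := by
  rw [cells, Finset.mem_sdiff, YoungDiagram.mem_cells, YoungDiagram.mem_cells,
    YoungDiagram.mem_iff_lt_rowLen, YoungDiagram.mem_iff_lt_rowLen]
  omega

theorem cells_convex (s : RShape) :
    ∀ x ∈ s.cells, ∀ z ∈ s.cells, ∀ y, x ≤ y → y ≤ z → y ∈ s.cells := by
  intro x hx z hz y hxy hyz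
  simp only [cells, Finset.mem_sdiff] at *
  exact ⟨s.outer.isLowerSet hyz hz.1, fun h => hx.2 (s.inner.isLowerSet hxy h)⟩

/-- The shift of the contents of an r-shape. -/
def shift (s : RShape) : ℤ := s.root - 1 + s.length

theorem content_eq (s : RShape) (x : ℕ × ℕ) : s.content x.1 x.2 = cellContent s.shift x := by
  simp only [content, cellContent, shift]
  ring

end RShape

/-! ### Jacobi-Trudi entries as functions of contents. -/

section Entries

variable {R : Type*} [CommRing R]

theorem hSuper_of_neg (u : Finset ℤ) (y : ℤ → R) (v : Finset ℤ) (z : ℤ → R) {N : ℤ} (h : N < 0) :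
    hSuper u y v z N = 0 := if_pos h

theorem hSuper_zero (u : Finset ℤ) (y : ℤ → R) (v : Finset ℤ) (z : ℤ → R) :
    hSuper u y v z 0 = 1 := by
  simp [hSuper, hSym, eSym]

/-- The supersymmetric function of a row with the contents `l, …, r - 1`, with flags `A` and `B`
that depend on the contents of its ends. -/
def rowKernel (A B : ℤ → ℤ) (y z : ℤ → R) (l r : ℤ) : R :=
  hSuper (Finset.Icc (A l) (B (r - 1))) y
    (Finset.Icc (A l + l) (B (r - 1) + (r - 1))) z (r - l)

theorem rowKernel_self (A B : ℤ → ℤ) (y z : ℤ → R) (p : ℤ) : rowKernel A B y z p p = 1 := by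
  rw [rowKernel, sub_self, hSuper_zero]

theorem rowKernel_of_lt (A B : ℤ → ℤ) (y z : ℤ → R) (p q : ℤ) (h : q < p) :
    rowKernel A B y z p q = 0 := hSuper_of_neg _ _ _ _ (by omega)

/-- The degree `λ_i - μ_j - i + j` is one more than the right content of row `i` minus the left
content of row `j`, so the shape enters only through contents. -/
theorem hSuper_eq_rowKernel (s : RShape) (A B : ℤ → ℤ) (y z : ℤ → R) (i j : ℕ) :
    hSuper (Finset.Icc (A (s.leftContent j)) (B (s.rightContent i))) y
      (Finset.Icc (A (s.leftContent j) + s.leftContent j)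
        (B (s.rightContent i) + s.rightContent i)) z
      ((s.outer.rowLen i : ℤ) - s.inner.rowLen j - i + j) =
    rowKernel A B y z (s.leftContent j) (s.rightContent i + 1) := by
  rw [rowKernel, add_sub_cancel_right]
  congr 1
  simp only [RShape.leftContent, RShape.rightContent, RShape.content]
  ring

end Entries

/-! ### Rows of strips -/

section Strip

variable (U : ℤ → Prop) (p q : ℤ)

theorem stripCell_row_antitone {t t' : ℤ} (h : t ≤ t') :
    (stripCell U p q t').1 ≤ (stripCell U p q t).1 :=
  Finset.card_le_card (Finset.filter_subset_filter _ (Finset.Ico_subset_Ico h le_rfl))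

theorem stripCell_row_succ {t : ℤ} (h : t < q) :
    (stripCell U p q t).1 = (stripCell U p q (t + 1)).1 + if U t then 1 else 0 := by
  have e : Finset.Ico t q = insert t (Finset.Ico (t + 1) q) := by
    ext u; simp only [Finset.mem_Ico, Finset.mem_insert]; omega
  simp only [stripCell]
  rw [e, Finset.filter_insert]
  split_ifs
  · rw [Finset.card_insert_of_notMem (by simp)]
  · rfl

theorem stripCell_row_last : (stripCell U p q q).1 = 0 := by simp [stripCell]

theorem stripShape_length (h : p ≤ q) :
    (stripShape U p q).length = (stripCell U p q p).1 + 1 := by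
  have h1 : ∀ r, r < (stripShape U p q).length ↔ r < (stripCell U p q p).1 + 1 := by
    intro r
    rw [RShape.length, ← YoungDiagram.mem_iff_lt_colLen, ← YoungDiagram.mem_cells]
    simp only [stripShape, Finset.mem_biUnion, Finset.mem_Icc, Finset.mem_Iic]
    constructor
    · rintro ⟨t, ht, h2⟩
      exact Nat.lt_succ_of_le (h2.1.trans (stripCell_row_antitone U p q ht.1))
    · intro h2
      exact ⟨p, ⟨le_rfl, h⟩, Nat.le_of_lt_succ h2, Nat.zero_le _⟩
  have h2 := h1 (stripShape U p q).length
  have h3 := h1 ((stripCell U p q p).1 + 1)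
  omega

/-- The up steps before `t` are the rows below the cell, and together with the right steps before
`t` they number `t - p`. -/
theorem stripShape_content {t : ℤ} (h1 : p ≤ t) (h2 : t ≤ q) :
    (stripShape U p q).content (stripCell U p q t).1 (stripCell U p q t).2 = t := by
  have e : Finset.Ico p q = Finset.Ico p t ∪ Finset.Ico t q :=
    (Finset.Ico_union_Ico_eq_Ico h1 h2).symm
  have h3 : (stripCell U p q p).1 =
      ((Finset.Ico p t).filter fun c => U c).card + (stripCell U p q t).1 := by
    simp only [stripCell]
    rw [e, Finset.filter_union, Finset.card_union_of_disjoint]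
    exact Finset.disjoint_filter_filter (Finset.Ico_disjoint_Ico_consecutive p t q)
  have h4 : ((Finset.Ico p t).filter fun c => U c).card + (stripCell U p q t).2 =
      (Finset.Ico p t).card := Finset.card_filter_add_card_filter_not _
  rw [Int.card_Ico] at h4
  rw [RShape.content, stripShape_length U p q (h1.trans h2), h3]
  simp only [stripShape]
  push_cast
  omega

/-- Along the strip the row number falls to `0` in steps of at most one, so no row is skipped. -/
theorem exists_stripCell_row {r : ℕ} (hpq : p ≤ q) (hr : r ≤ (stripCell U p q p).1) :
    ∃ t, p ≤ t ∧ t ≤ q ∧ (stripCell U p q t).1 = r := by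
  obtain ⟨t, ht, hmax⟩ := ((Finset.Icc p q).filter
    fun u => r ≤ (stripCell U p q u).1).exists_max_image id
    ⟨p, Finset.mem_filter.2 ⟨Finset.mem_Icc.2 ⟨le_rfl, hpq⟩, hr⟩⟩
  simp only [Finset.mem_filter, Finset.mem_Icc, id] at ht hmax
  refine ⟨t, ht.1.1, ht.1.2, ?_⟩
  rcases eq_or_lt_of_le ht.1.2 with h | h
  · subst h
    have := stripCell_row_last U p t
    omega
  · have h1 := stripCell_row_succ U p q h
    have h2 : ¬ r ≤ (stripCell U p q (t + 1)).1 := fun h3 => by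
      have := hmax (t + 1) ⟨⟨by omega, by omega⟩, h3⟩
      omega
    split_ifs at h1 <;> omega

/-- The contents of the ends of a row of a strip. -/
theorem strip_row_ends {r : ℕ} (hpq : p ≤ q) (hr : r ≤ (stripCell U p q p).1) :
    (p ≤ (stripShape U p q).leftContent r ∧
      (stripCell U p q ((stripShape U p q).leftContent r)).1 = r) ∧
    ((stripShape U p q).rightContent r ≤ q ∧
      (stripCell U p q ((stripShape U p q).rightContent r)).1 = r) ∧
    ∀ t, p ≤ t → t ≤ q → (stripCell U p q t).1 = r →
      (stripShape U p q).leftContent r ≤ t ∧ t ≤ (stripShape U p q).rightContent r := by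
  set σ := stripShape U p q with hσ
  have hrow : ∀ t, p ≤ t → t ≤ q → (stripCell U p q t).1 = r →
      σ.inner.rowLen r ≤ (stripCell U p q t).2 ∧ (stripCell U p q t).2 < σ.outer.rowLen r ∧
        t = σ.content r (stripCell U p q t).2 := by
    intro t h1 h2 h3
    have h4 : stripCell U p q t ∈ σ.cells :=
      (mem_stripShape_cells U p q _).2 ⟨t, Finset.mem_Icc.2 ⟨h1, h2⟩, rfl⟩
    have h5 := (σ.mem_cells_iff (stripCell U p q t).1 (stripCell U p q t).2).1 h4
    have h6 := stripShape_content U p q h1 h2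
    rw [h3] at h5 h6
    exact ⟨h5.1, h5.2, h6.symm⟩
  have hcell : ∀ j, σ.inner.rowLen r ≤ j → j < σ.outer.rowLen r →
      p ≤ σ.content r j ∧ σ.content r j ≤ q ∧ (stripCell U p q (σ.content r j)).1 = r := by
    intro j h1 h2
    obtain ⟨t, ht, h3⟩ := (mem_stripShape_cells U p q (r, j)).1 ((σ.mem_cells_iff r j).2 ⟨h1, h2⟩)
    rw [Finset.mem_Icc] at ht
    have h4 := stripShape_content U p q ht.1 ht.2
    rw [← h3] at h4
    simp only at h4
    rw [h4]
    exact ⟨ht.1, ht.2, by rw [← h3]⟩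
  obtain ⟨t₀, h1, h2, h3⟩ := exists_stripCell_row U p q hpq hr
  obtain ⟨h4, h5, -⟩ := hrow t₀ h1 h2 h3
  have hl := hcell _ le_rfl (h4.trans_lt h5)
  have hr' := hcell (σ.outer.rowLen r - 1) (by omega) (by omega)
  rw [Nat.cast_sub (by omega), Nat.cast_one] at hr'
  refine ⟨⟨hl.1, hl.2.2⟩, ⟨hr'.2.1, hr'.2.2⟩, fun t h6 h7 h8 => ?_⟩
  obtain ⟨h9, h10, h11⟩ := hrow t h6 h7 h8
  rw [h11]
  simp only [RShape.leftContent, RShape.rightContent, RShape.content]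
  constructor <;> omega

/-- The row flagged supersymmetric Schur function of a strip, with flags that depend on contents,
is a ribbon kernel. -/
theorem strip_rowFlaggedSchur {R : Type*} [CommRing R] (A B : ℤ → ℤ) (y z : ℤ → R) (hpq : p ≤ q) :
    (stripShape U p q).rowFlaggedSchur (stripShape U p q).length
      (fun r => A ((stripShape U p q).leftContent r))
      (fun r => B ((stripShape U p q).rightContent r)) y z =
    ribbonKernel (rowKernel A B y z) (fun t => U (t - 1)) p (q + 1) := by
  have hends := fun r => strip_row_ends U p q (r := r) hpq
  have hlen := stripShape_length U p q hpq
  set σ := stripShape U p q with hσ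
  set N := (stripCell U p q p).1 with hN
  have hlast : (stripCell U p q q).1 = 0 := stripCell_row_last U p q
  have hanti := fun t t' => stripCell_row_antitone U p q (t := t) (t' := t')
  have hlr : ∀ r ≤ N, σ.leftContent r ≤ σ.rightContent r := fun r hr => by
    obtain ⟨t, h1, h2, h3⟩ := exists_stripCell_row U p q hpq hr
    have := (hends r hr).2.2 t h1 h2 h3
    omega
  -- Contents grow upwards while rows are numbered from the top, so row `i + 1` ends just before row
  -- `i` begins. One sequence therefore records both ends of every row.
  let x : ℕ → ℤ := fun i => if i = 0 then q + 1 else σ.leftContent (i - 1)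
  have hx0 : x 0 = q + 1 := rfl
  have hxs : ∀ i, x (i + 1) = σ.leftContent i := fun i => rfl
  have hleftN : σ.leftContent N = p :=
    le_antisymm ((hends N le_rfl).2.2 p le_rfl hpq rfl).1 (hends N le_rfl).1.1
  have hstep : ∀ r, r + 1 ≤ N → p < σ.leftContent r ∧ U (σ.leftContent r - 1) ∧
      σ.rightContent (r + 1) + 1 = σ.leftContent r := by
    intro r hr
    obtain ⟨⟨h1, h2⟩, ⟨h3, h4⟩, h5⟩ := hends r (by omega)
    obtain ⟨⟨h1', h2'⟩, ⟨h3', h4'⟩, h5'⟩ := hends (r + 1) hr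
    have h6 := hlr r (by omega)
    have h7 : p < σ.leftContent r := by
      refine lt_of_le_of_ne h1 fun h => ?_
      rw [← h] at h2
      omega
    have h8 := stripCell_row_succ U p q (t := σ.leftContent r - 1) (by omega)
    rw [sub_add_cancel, h2] at h8
    have h9 : (stripCell U p q (σ.leftContent r - 1)).1 ≠ r := fun h => by
      have := (h5 _ (by omega) (by omega) h).1
      omega
    split_ifs at h8 with h10
    · refine ⟨h7, h10, ?_⟩
      have h11 := (h5' _ (by omega) (by omega) h8).2
      have h12 : σ.rightContent (r + 1) < σ.leftContent r := by
        by_contra h13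
        have := hanti _ _ (not_lt.1 h13)
        omega
      omega
    · omega
  have hxr : ∀ i ≤ N, σ.rightContent i + 1 = x i := by
    intro i hi
    rcases i with _ | i
    · rw [hx0]
      have h1 := hends 0 hi
      have h2 := h1.2.2 q hpq le_rfl hlast
      omega
    · rw [hxs]
      exact (hstep i hi).2.2
  have key := det_ribbon (rowKernel A B y z) (rowKernel_self A B y z) (rowKernel_of_lt A B y z)
    -- A new row begins at content `t` exactly when the cell of content `t - 1` goes up; this is the
    -- shift by one.
    N x (fun t => U (t - 1)) (fun i hi => by
      rw [hxs, ← hxr i hi]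
      have := hlr i hi
      omega) (by
    intro t h1 h2
    rw [hxs, hleftN] at h1
    rw [hx0] at h2
    constructor
    · intro h3
      have h4 := stripCell_row_succ U p q (t := t - 1) (by omega)
      rw [sub_add_cancel, if_pos h3] at h4
      have h5 := hanti p (t - 1) (by omega)
      have hr : (stripCell U p q t).1 ≤ N := by omega
      obtain ⟨⟨h6, h7⟩, -, h8⟩ := hends _ hr
      refine ⟨(stripCell U p q t).1 + 1, by omega, by omega, ?_⟩
      rw [hxs]
      refine le_antisymm ?_ (h8 t (by omega) (by omega) rfl).1
      by_contra h9
      have := hanti _ (t - 1) (Int.le_sub_one_of_lt (not_le.1 h9))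
      omega
    · rintro ⟨i, h3, h4, rfl⟩
      obtain ⟨r, rfl⟩ : ∃ r, i = r + 1 := ⟨i - 1, by omega⟩
      rw [hxs]
      exact (hstep r h4).2.1)
  rw [hxs, hleftN, hx0] at key
  rw [← key, hlen, RShape.rowFlaggedSchur]
  congr 1
  ext i j
  have hi : (i : ℕ) ≤ N := by omega
  simp only [Matrix.of_apply]
  rw [hSuper_eq_rowKernel, hxr i hi, hxs]

end Strip

/-! ### The Jacobi-Trudi determinant as the determinant of a cell matrix -/

namespace RShape

/-- Going up a diagonal moves left, while the inner rows do not get shorter, so no higher cell of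
this content exists. This is what makes the given lower flag a function of contents;
`rowMax_rightContent` does the same for the upper flag. -/
theorem rowMin_leftContent (s : RShape) {i : ℕ} (h : s.inner.rowLen i < s.outer.rowLen i) :
    s.rowMin (s.leftContent i) = i := by
  have hmem : i ∈ {i' : ℕ | ∃ j : ℕ, (i', j) ∈ s.cells ∧ s.content i' j = s.leftContent i} :=
    ⟨_, (s.mem_cells_iff _ _).2 ⟨le_rfl, h⟩, rfl⟩
  refine le_antisymm (Nat.sInf_le hmem) (le_csInf ⟨i, hmem⟩ ?_)
  rintro i' ⟨j, hj, hc⟩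
  by_contra hlt
  have h1 := ((s.mem_cells_iff _ _).1 hj).1
  have h2 := s.inner.rowLen_anti i' i (by omega)
  simp only [leftContent, content] at hc
  omega

theorem rowMax_rightContent (s : RShape) {i : ℕ} (h : s.inner.rowLen i < s.outer.rowLen i) :
    s.rowMax (s.rightContent i) = i := by
  have hmem : i ∈ {i' : ℕ | ∃ j : ℕ, (i', j) ∈ s.cells ∧ s.content i' j = s.rightContent i} := by
    refine ⟨s.outer.rowLen i - 1, (s.mem_cells_iff _ _).2 (by omega), ?_⟩
    rw [rightContent, Nat.cast_sub (by omega), Nat.cast_one]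
  have hub : ∀ i' ∈ {i' : ℕ | ∃ j : ℕ, (i', j) ∈ s.cells ∧ s.content i' j = s.rightContent i},
      i' ≤ i := by
    rintro i' ⟨j, hj, hc⟩
    by_contra hlt
    have h1 := ((s.mem_cells_iff _ _).1 hj).2
    have h2 := s.outer.rowLen_anti i i' (by omega)
    simp only [rightContent, content] at hc
    omega
  exact le_antisymm (csSup_le ⟨i, hmem⟩ hub) (le_csSup ⟨i, hub⟩ hmem)

/-- The nonempty rows of a connected shape are consecutive. -/
theorem row_nonempty_of_between (s : RShape) (hs : CellsConnected s.cells) {i₁ i i₂ : ℕ}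
    (h1 : s.inner.rowLen i₁ < s.outer.rowLen i₁) (h2 : s.inner.rowLen i₂ < s.outer.rowLen i₂)
    (hi1 : i₁ < i) (hi2 : i < i₂) : s.inner.rowLen i < s.outer.rowLen i := by
  obtain ⟨u, -, v, hv, h3, h4, h5⟩ := hs.exists_boundary (fun x => x.1 < i)
    ((s.mem_cells_iff i₁ _).2 ⟨le_rfl, h1⟩) ((s.mem_cells_iff i₂ _).2 ⟨le_rfl, h2⟩) hi1
    (by simp only; omega)
  have h6 := (s.mem_cells_iff v.1 v.2).1 hv
  rw [show v.1 = i by omega] at h6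
  omega

variable {R : Type*} [CommRing R]

/-- Empty rows do not contribute to the Jacobi-Trudi determinant. -/
theorem rowFlaggedSchur_eq_det (s : RShape) (hs : CellsConnected s.cells) (n : ℕ) (a' b' : ℕ → ℤ)
    (y z : ℤ → R) : s.rowFlaggedSchur n a' b' y z =
      Matrix.det (Matrix.of fun i j : {i : Fin n // s.inner.rowLen i < s.outer.rowLen i} =>
        rowKernel (fun c => a' (s.rowMin c)) (fun c => b' (s.rowMax c)) y z
          (s.leftContent i.1) (s.rightContent j.1 + 1)) := by
  let P : Fin n → Prop := fun i => s.inner.rowLen i < s.outer.rowLen i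
  have hP : ∀ i, ¬ P i → s.outer.rowLen i = s.inner.rowLen i := fun i hi => by
    have h1 : s.inner.rowLen i ≤ s.outer.rowLen i := by
      by_contra h
      have h2 : ((i : ℕ), s.outer.rowLen i) ∈ s.inner :=
        YoungDiagram.mem_iff_lt_rowLen.2 (not_le.1 h)
      have h3 := YoungDiagram.mem_iff_lt_rowLen.1 (s.inner_le h2)
      omega
    simp only [P] at hi
    omega
  -- All nonempty rows receive the common block label `i₀`, and every empty row keeps its own index.
  -- If no row is nonempty, the label `n` belongs to no index.
  obtain ⟨i₀, hi₀⟩ : ∃ i₀ : ℕ, (∃ i, P i ∧ (i : ℕ) = i₀) ∨ ((∀ i, ¬ P i) ∧ i₀ = n) := by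
    by_cases h : ∃ i, P i
    · obtain ⟨i, hi⟩ := h
      exact ⟨i, Or.inl ⟨i, hi, rfl⟩⟩
    · exact ⟨n, Or.inr ⟨fun i hi => h ⟨i, hi⟩, rfl⟩⟩
  let b : Fin n → ℕ := fun i => if P i then i₀ else i
  have hb : ∀ i, b i = i₀ ↔ P i := by
    intro i
    simp only [b]
    split_ifs with h
    · simp [h]
    · simp only [h, iff_false]
      rintro h1
      rcases hi₀ with ⟨j, hj, hj'⟩ | ⟨-, h2⟩
      · exact h (Fin.ext (h1.trans hj'.symm) ▸ hj)
      · have := i.2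
        omega
  let A : Matrix (Fin n) (Fin n) R := Matrix.of fun i j : Fin n =>
    hSuper (Finset.Icc (a' j) (b' i)) y
      (Finset.Icc (a' j + s.leftContent j) (b' i + s.rightContent i)) z
      ((s.outer.rowLen i : ℤ) - s.inner.rowLen j - i + j)
  have hA0 : ∀ i j : Fin n, j < i → (¬ P i ∨ ¬ P j) → A i j = 0 := by
    intro i j hji h
    refine hSuper_of_neg _ _ _ _ ?_
    have h1 := s.inner.rowLen_anti j i hji.le
    have h2 := s.outer.rowLen_anti j i hji.le
    have h3 : (j : ℕ) < i := hji
    rcases h with h | h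
    · have := hP i h
      omega
    · have := hP j h
      omega
  have hA1 : ∀ i : Fin n, ¬ P i → A i i = 1 := by
    intro i hi
    simp only [A, Matrix.of_apply]
    rw [hP i hi, show ((s.inner.rowLen i : ℤ) - s.inner.rowLen i - (i : ℕ) + (i : ℕ)) = 0 by ring,
      hSuper_zero]
  -- An entry below the diagonal in an empty row or column has negative degree. Since the nonempty
  -- rows are consecutive, giving them one label respects the order.
  have hT : A.BlockTriangular b := by
    intro i j hij
    have hne : ¬ (P i ∧ P j) := fun h => by
      simp only [b, if_pos h.1, if_pos h.2, lt_irrefl] at hij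
    have hor : ¬ P i ∨ ¬ P j := by tauto
    refine hA0 i j ?_ hor
    by_contra hle
    have hle' : (i : ℕ) ≤ j := not_lt.1 hle
    by_cases hPi : P i <;> by_cases hPj : P j
    · exact hne ⟨hPi, hPj⟩
    · simp only [b, if_pos hPi, if_neg hPj] at hij
      rcases hi₀ with ⟨l, hl, hl'⟩ | ⟨h, -⟩
      · have h1 : (i : ℕ) ≠ j := fun h => hPj (Fin.ext h ▸ hPi)
        exact hPj (s.row_nonempty_of_between hs hPi hl (by omega) (by omega))
      · exact h i hPi
    · simp only [b, if_neg hPi, if_pos hPj] at hij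
      rcases hi₀ with ⟨l, hl, hl'⟩ | ⟨h, -⟩
      · have h1 : (i : ℕ) ≠ j := fun h => hPi (Fin.ext h ▸ hPj)
        exact hPi (s.row_nonempty_of_between hs hl hPj (by omega) (by omega))
      · exact h j hPj
    · simp only [b, if_neg hPi, if_neg hPj] at hij
      omega
  change A.det = _
  rw [hT.det, Finset.prod_eq_single i₀]
  · let f : {i // b i = i₀} ≃ {i : Fin n // P i} := Equiv.subtypeEquivRight hb
    -- Transposition puts left ends on the row index, as in the cell matrix.
    rw [← Matrix.det_transpose, ← Matrix.det_submatrix_equiv_self f]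
    congr 1
    ext i j
    simp only [Matrix.transpose_apply, Matrix.toSquareBlock_def, Matrix.submatrix_apply,
      Matrix.of_apply, A, f, Equiv.subtypeEquivRight_apply_coe]
    rw [← hSuper_eq_rowKernel, s.rowMin_leftContent ((hb _).1 i.2),
      s.rowMax_rightContent ((hb _).1 j.2)]
  · intro c hc hne
    obtain ⟨i, -, rfl⟩ := Finset.mem_image.1 hc
    have hPi : ¬ P i := fun h => hne ((hb i).2 h)
    have hu : ∀ j, b j = b i → j = i := fun j hj => by
      have hPj : ¬ P j := fun h => hne (hj ▸ (hb j).2 h)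
      simp only [b, if_neg hPi, if_neg hPj] at hj
      exact Fin.ext hj
    let _ : Unique {j // b j = b i} := ⟨⟨⟨i, rfl⟩⟩, fun j => Subtype.ext (hu j j.2)⟩
    rw [Matrix.det_unique]
    exact hA1 i hPi
  · intro h
    have : IsEmpty {i // b i = i₀} :=
      ⟨fun i => h (Finset.mem_image.2 ⟨i, Finset.mem_univ _, i.2⟩)⟩
    exact Matrix.det_isEmpty

/-- With no content entered from below, the chains of the cell matrix are the rows of the shape read
from left to right, and a kernel without breaks is a single row function. -/
theorem rowFlaggedSchur_eq_det_cellMatrix (s : RShape) (hs : CellsConnected s.cells) (n : ℕ)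
    (hn : s.length ≤ n) (a' b' : ℕ → ℤ) (y z : ℤ → R) :
    s.rowFlaggedSchur n a' b' y z =
      (cellMatrix s.cells s.shift (rowKernel (fun c => a' (s.rowMin c)) (fun c => b' (s.rowMax c))
        y z) fun _ => False).det := by
  rw [s.rowFlaggedSchur_eq_det hs]
  set M := rowKernel (fun c => a' (s.rowMin c)) (fun c => b' (s.rowMax c)) y z with hM
  let κ := {i : Fin n // s.inner.rowLen i < s.outer.rowLen i}
  have hmem : ∀ (i : κ) (k : ℕ), k ≤ s.outer.rowLen i.1 - s.inner.rowLen i.1 - 1 →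
      ((i.1 : ℕ), s.inner.rowLen i.1 + k) ∈ s.cells := fun i k hk => by
    have := i.2
    rw [s.mem_cells_iff]
    omega
  let e : κ → ℕ → s.cells := fun i k =>
    if h : ((i.1 : ℕ), s.inner.rowLen i.1 + k) ∈ s.cells then ⟨_, h⟩
    else ⟨_, hmem i 0 (Nat.zero_le _)⟩
  have he : ∀ i k, k ≤ s.outer.rowLen i.1 - s.inner.rowLen i.1 - 1 →
      (e i k).1 = ((i.1 : ℕ), s.inner.rowLen i.1 + k) := fun i k hk => by
    simp only [e]
    rw [dif_pos (hmem i k hk)]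
  have hprec : ∀ x y, Precedes s.shift (fun _ => False) x y ↔ y.1 = x.1 ∧ y.2 + 1 = x.2 :=
    fun x y => by simp [Precedes]
  rw [det_chains (fun i : κ => s.outer.rowLen i.1 - s.inner.rowLen i.1 - 1) e]
  · congr 1
    ext i j
    have h1 := i.2
    have h2 := j.2
    simp only [Matrix.of_apply, cellMatrix]
    rw [if_neg]
    · have h3 : cellContent s.shift (e i 0) = s.leftContent i.1 := by
        rw [he i 0 (Nat.zero_le _), ← s.content_eq]
        rfl
      have h4 : cellContent s.shift (e j (s.outer.rowLen j.1 - s.inner.rowLen j.1 - 1)) =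
          s.rightContent j.1 := by
        rw [he j _ le_rfl, ← s.content_eq, RShape.rightContent]
        congr 1
        push_cast
        omega
      rw [h3, h4]
      rcases lt_trichotomy (s.leftContent i.1) (s.rightContent j.1 + 1) with h5 | h5 | h5
      · rw [ribbonKernel_of_forall_not M _ h5 fun _ _ _ h => h]
      · rw [h5, ribbonKernel_self, hM, rowKernel_self]
      · rw [ribbonKernel_of_lt M _ h5, hM, rowKernel_of_lt _ _ _ _ _ _ h5]
    · rintro ⟨b, hb, h3⟩
      rw [hprec, he i 0 (Nat.zero_le _)] at h3
      have h4 := (s.mem_cells_iff b.1 b.2).1 hb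
      rw [h3.1] at h4
      simp only at h3 h4
      omega
  · intro i k j l hk hl h
    have h1 := congrArg Subtype.val h
    rw [he i k hk, he j l hl, Prod.ext_iff] at h1
    have h2 : i = j := Subtype.ext (Fin.ext h1.1)
    subst h2
    exact ⟨rfl, by simpa using h1.2⟩
  · rintro ⟨⟨i, j⟩, hx⟩
    have h1 := (s.mem_cells_iff i j).1 hx
    have h2 : i < n := by
      refine lt_of_lt_of_le ?_ hn
      rw [RShape.length, ← YoungDiagram.mem_iff_lt_colLen, YoungDiagram.mem_iff_lt_rowLen]
      omega
    refine ⟨⟨⟨i, h2⟩, by simp only; omega⟩, j - s.inner.rowLen i, by simp only; omega, ?_⟩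
    refine Subtype.ext ?_
    rw [he _ _ (by simp only; omega)]
    ext <;> simp only
    omega
  · intro i k hk y
    simp only [cellMatrix, Matrix.of_apply, hprec]
    have h1 : ∀ y, y = e i k ↔ y.1.1 = (e i (k + 1)).1.1 ∧ y.1.2 + 1 = (e i (k + 1)).1.2 := by
      intro y
      rw [Subtype.ext_iff, he i k hk.le, he i (k + 1) hk, Prod.ext_iff]
      simp only
      omega
    rw [if_pos ⟨(e i k).1, (e i k).2, (h1 _).1 rfl⟩]
    simp only [h1]

end RShape

/-! ### Ribbons -/

namespace IsRibbon

variable {T : Finset (ℕ × ℕ)}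

theorem convex (hT : IsRibbon T) : ∀ x ∈ T, ∀ z ∈ T, ∀ y, x ≤ y → y ≤ z → y ∈ T := by
  obtain ⟨α, β, -, rfl⟩ := hT.skew
  intro x hx z hz y hxy hyz
  simp only [Finset.mem_sdiff] at *
  exact ⟨α.isLowerSet hyz hz.1, fun h => hx.2 (β.isLowerSet hxy h)⟩

/-- By convexity, two cells on one diagonal would force a `2 × 2` block. -/
theorem eq_of_content_eq (hT : IsRibbon T) (K : ℤ) {x y : ℕ × ℕ} (hx : x ∈ T) (hy : y ∈ T)
    (h : cellContent K x = cellContent K y) : x = y := by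
  have key : ∀ x ∈ T, ∀ y ∈ T, cellContent K x = cellContent K y → ¬ x.1 < y.1 := by
    rintro ⟨i, j⟩ hx ⟨i', j'⟩ hy h hlt
    simp only [cellContent] at h hlt
    have hc : ∀ u : ℕ × ℕ, i ≤ u.1 → j ≤ u.2 → u.1 ≤ i + 1 → u.2 ≤ j + 1 → u ∈ T :=
      fun u h1 h2 h3 h4 => hT.convex _ hx _ hy u ⟨h1, h2⟩ ⟨by simp only; omega, by simp only; omega⟩
    exact hT.no_block i j ⟨hx, hc _ (by simp) (by simp) (by simp) (by simp),
      hc _ (by simp) (by simp) (by simp) (by simp), hc _ (by simp) (by simp) (by simp) (by simp)⟩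
  have h1 := key x hx y hy h
  have h2 := key y hy x hx h.symm
  simp only [cellContent] at h
  exact Prod.ext (by omega) (by omega)

/-- The head has smaller content than `x`, so by connectedness some edge leaves the cells of content
at least that of `x`. Its upper end has the content of `x`, hence is `x`. -/
theorem exists_pred (hT : IsRibbon T) {x h : ℕ × ℕ} (hh : IsHead T h) (hx : x ∈ T) (hne : x ≠ h) :
    ∃ y ∈ T, (y.1 = x.1 + 1 ∧ y.2 = x.2) ∨ (y.1 = x.1 ∧ y.2 + 1 = x.2) := by
  have h1 := hh.2 x hx
  obtain ⟨u, hu, v, hv, h2, h3, h4⟩ := hT.connected.exists_boundary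
    (fun u => cellContent 0 x ≤ cellContent 0 u) hx hh.1 le_rfl (fun h2 => hne (by
      simp only [cellContent] at h2
      exact Prod.ext (by omega) (by omega)))
  have h5 : u = x := hT.eq_of_content_eq 0 hu hx (by simp only [cellContent] at *; omega)
  subst h5
  refine ⟨v, hv, ?_⟩
  simp only [cellContent] at h3
  omega

theorem exists_succ (hT : IsRibbon T) {x t : ℕ × ℕ} (ht : IsTail T t) (hx : x ∈ T) (hne : x ≠ t) :
    ∃ y ∈ T, (y.1 + 1 = x.1 ∧ y.2 = x.2) ∨ (y.1 = x.1 ∧ y.2 = x.2 + 1) := by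
  have h1 := ht.2 x hx
  obtain ⟨u, hu, v, hv, h2, h3, h4⟩ := hT.connected.exists_boundary
    (fun u => cellContent 0 u ≤ cellContent 0 x) hx ht.1 le_rfl (fun h2 => hne (by
      simp only [cellContent] at h2
      exact Prod.ext (by omega) (by omega)))
  have h5 : u = x := hT.eq_of_content_eq 0 hu hx (by simp only [cellContent] at *; omega)
  subst h5
  refine ⟨v, hv, ?_⟩
  simp only [cellContent] at h3
  omega

end IsRibbon

/-! ### Directions in outer decompositions -/

namespace OuterDecomposition

variable {s : RShape} {k : ℕ} (D : OuterDecomposition s k)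

theorem mem_cells {i : Fin k} {x : ℕ × ℕ} (hx : x ∈ D.ribbon i) : x ∈ s.cells := by
  rw [← D.cover]
  exact Finset.mem_biUnion.2 ⟨i, Finset.mem_univ _, hx⟩

theorem exists_ribbon {x : ℕ × ℕ} (hx : x ∈ s.cells) : ∃ i, x ∈ D.ribbon i := by
  rw [← D.cover] at hx
  simpa using hx

theorem ribbon_unique {i j : Fin k} {x : ℕ × ℕ} (hi : x ∈ D.ribbon i) (hj : x ∈ D.ribbon j) :
    i = j := by
  by_contra h
  exact Finset.disjoint_left.1 (D.disjoint i j h) hi hj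

theorem goesUp_of_above {i : Fin k} {x y : ℕ × ℕ} (hx : x ∈ D.ribbon i) (hy : y ∈ D.ribbon i)
    (h1 : y.1 + 1 = x.1) (h2 : y.2 = x.2) : D.GoesUp x :=
  ⟨i, hx, Or.inl ⟨y, hy, h1, h2⟩⟩

theorem above_mem_of_goesUp {i : Fin k} {x y : ℕ × ℕ} (hx : x ∈ D.ribbon i) (hy : y ∈ s.cells)
    (h1 : y.1 + 1 = x.1) (h2 : y.2 = x.2) (h : D.GoesUp x) : y ∈ D.ribbon i := by
  obtain ⟨j, hj, ⟨w, hw, h3, h4⟩ | ⟨-, h3⟩⟩ := h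
  · rw [D.ribbon_unique hx hj]
    rwa [show y = w from Prod.ext (by omega) (by omega)]
  · exact (h3 y hy ⟨h1, h2⟩).elim

theorem not_goesUp_of_right {i : Fin k} {x y : ℕ × ℕ} (hx : x ∈ D.ribbon i) (hy : y ∈ D.ribbon i)
    (h1 : y.1 = x.1) (h2 : y.2 = x.2 + 1) : ¬ D.GoesUp x := by
  rintro ⟨j, hj, ⟨w, hw, h3, h4⟩ | ⟨h3, -⟩⟩
  · rw [← D.ribbon_unique hx hj] at hw
    have := (D.isRibbon i).eq_of_content_eq 0 hw hy (by simp only [cellContent]; omega)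
    rw [this] at h3
    omega
  · rw [← D.ribbon_unique hx hj] at h3
    have := ((D.isTail i).2 y hy).2
    rw [← h3] at this
    omega

theorem right_mem_of_not_goesUp {i : Fin k} {x y : ℕ × ℕ} (hx : x ∈ D.ribbon i) (hy : y ∈ s.cells)
    (h1 : y.1 = x.1) (h2 : y.2 = x.2 + 1) (h : ¬ D.GoesUp x) : y ∈ D.ribbon i := by
  by_cases hxt : x = D.tail i
  · rcases D.tail_perimeter i with h3 | h3
    · exact (h ⟨i, hx, Or.inr ⟨hxt, hxt ▸ h3⟩⟩).elim
    · exact (h3 y hy (by rw [← hxt]; exact ⟨h1, h2⟩)).elim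
  · obtain ⟨w, hw, h3 | h3⟩ := (D.isRibbon i).exists_succ (D.isTail i) hx hxt
    · exact (h (D.goesUp_of_above hx hw h3.1 h3.2)).elim
    · rwa [show y = w from Prod.ext (by omega) (by omega)]

/-- The cell `(i, j + 1)` between the two decides. It has a left and a lower neighbour in the shape,
so the perimeter condition forbids it to be a head, and it is entered from one of them. It cannot be
entered from both, since a ribbon has at most one cell of each content. -/
theorem goesUp_diagonal {i j : ℕ} (hx : (i, j) ∈ s.cells) (hx' : (i + 1, j + 1) ∈ s.cells) :
    D.GoesUp (i, j) ↔ D.GoesUp (i + 1, j + 1) := by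
  have hy : (i, j + 1) ∈ s.cells :=
    s.cells_convex _ hx _ hx' _ ⟨by simp, by simp⟩ ⟨by simp, by simp⟩
  obtain ⟨a, ha⟩ := D.exists_ribbon hx
  obtain ⟨a', ha'⟩ := D.exists_ribbon hx'
  obtain ⟨t, ht⟩ := D.exists_ribbon hy
  constructor
  · intro h
    have hyh : (i, j + 1) ≠ D.head t := by
      intro h1
      rcases D.head_perimeter t with h2 | h2 <;> rw [← h1] at h2
      · exact h2 _ hx ⟨rfl, rfl⟩
      · exact h2 _ hx' ⟨rfl, rfl⟩
    obtain ⟨w, hw, h1 | h1⟩ := (D.isRibbon t).exists_pred (D.isHead t) ht hyh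
    · rw [show w = (i + 1, j + 1) from Prod.ext h1.1 h1.2] at hw
      exact D.goesUp_of_above hw ht rfl rfl
    · rw [show w = (i, j) from Prod.ext h1.1 (by have := h1.2; simp only at this ⊢; omega)] at hw
      exact (D.not_goesUp_of_right hw ht rfl rfl h).elim
  · intro h
    by_contra hn
    have h1 := D.above_mem_of_goesUp ha' hy rfl rfl h
    have h2 := D.right_mem_of_not_goesUp ha hy rfl rfl hn
    have h3 := D.ribbon_unique h1 h2
    subst h3
    have := (D.isRibbon a').eq_of_content_eq 0 ha ha' (by simp only [cellContent]; omega)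
    simp at this

theorem goesUp_iff_of_content_eq {x x' : ℕ × ℕ} (hx : x ∈ s.cells) (hx' : x' ∈ s.cells)
    (h : cellContent s.shift x = cellContent s.shift x') : D.GoesUp x ↔ D.GoesUp x' := by
  have key : ∀ (d i j : ℕ), (i, j) ∈ s.cells → (i + d, j + d) ∈ s.cells →
      (D.GoesUp (i, j) ↔ D.GoesUp (i + d, j + d)) := by
    intro d
    induction d with
    | zero => intro i j _ _; rfl
    | succ d ih =>
      intro i j h1 h2
      have h3 : (i + d, j + d) ∈ s.cells :=
        s.cells_convex _ h1 _ h2 _ ⟨by simp, by simp⟩ ⟨by simp only; omega, by simp only; omega⟩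
      rw [ih i j h1 h3]
      exact D.goesUp_diagonal h3 h2
  obtain ⟨i, j⟩ := x
  obtain ⟨i', j'⟩ := x'
  simp only [cellContent] at h
  rcases le_total i i' with hi | hi
  · obtain ⟨d, rfl⟩ := Nat.exists_eq_add_of_le hi
    obtain rfl : j' = j + d := by omega
    exact key d i j hx hx'
  · obtain ⟨d, rfl⟩ := Nat.exists_eq_add_of_le hi
    obtain rfl : j = j' + d := by omega
    exact (key d i' j' hx' hx).symm

theorem stripUp_iff {x : ℕ × ℕ} (hx : x ∈ s.cells) :
    D.StripUp (cellContent s.shift x) ↔ D.GoesUp x := by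
  constructor
  · rintro ⟨w, hw, h1, h2⟩
    rw [s.content_eq] at h1
    exact (D.goesUp_iff_of_content_eq hw hx h1).1 h2
  · exact fun h => ⟨x, hx, s.content_eq x, h⟩

/-- Inside a ribbon, the cell before a given one is the one that precedes it in the cutting
strip. -/
theorem precedes_of_mem {i : Fin k} {x y : ℕ × ℕ} (hx : x ∈ D.ribbon i) (hy : y ∈ D.ribbon i)
    (h : (y.1 = x.1 + 1 ∧ y.2 = x.2) ∨ (y.1 = x.1 ∧ y.2 + 1 = x.2)) :
    Precedes s.shift (fun t => D.StripUp (t - 1)) x y := by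
  have hc : cellContent s.shift x - 1 = cellContent s.shift y := by
    simp only [cellContent]
    omega
  simp only [Precedes, hc, D.stripUp_iff (D.mem_cells hy)]
  rcases h with h | h
  · rwa [if_pos (D.goesUp_of_above hy hx h.1.symm h.2.symm)]
  · rwa [if_neg (D.not_goesUp_of_right hy hx h.1.symm h.2.symm)]

/-- The cell that precedes `x` in the cutting strip belongs to the ribbon of `x`. -/
theorem mem_of_precedes {i : Fin k} {x y : ℕ × ℕ} (hx : x ∈ D.ribbon i) (hy : y ∈ s.cells)
    (h : Precedes s.shift (fun t => D.StripUp (t - 1)) x y) : y ∈ D.ribbon i := by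
  have hc := h.content
  obtain ⟨j, hj⟩ := D.exists_ribbon hy
  simp only [Precedes, ← hc, D.stripUp_iff hy] at h
  split_ifs at h with h1
  · have := D.above_mem_of_goesUp hj (D.mem_cells hx) h.1.symm h.2.symm h1
    rwa [D.ribbon_unique hx this]
  · have := D.right_mem_of_not_goesUp hj (D.mem_cells hx) h.1.symm h.2.symm h1
    rwa [D.ribbon_unique hx this]

theorem exists_cell_of_content (i : Fin k) (l : ℕ)
    (hl : l ≤ (D.tailContent i - D.headContent i).toNat) :
    ∃ x ∈ D.ribbon i, cellContent s.shift x = D.headContent i + l := by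
  have hle : D.headContent i ≤ D.tailContent i := by
    have := (D.isHead i).2 _ (D.isTail i).1
    simp only [headContent, tailContent, s.content_eq, cellContent]
    omega
  -- Walking back from the tail, each predecessor lowers the content by one until the head is
  -- reached.
  have key : ∀ d ≤ (D.tailContent i - D.headContent i).toNat,
      ∃ x ∈ D.ribbon i, cellContent s.shift x = D.tailContent i - d := by
    intro d
    induction d with
    | zero => exact fun _ => ⟨D.tail i, (D.isTail i).1, by simp [tailContent, s.content_eq]⟩
    | succ d ih =>
      intro hd
      obtain ⟨x, hx, hc⟩ := ih (by omega)
      have hne : x ≠ D.head i := by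
        rintro rfl
        rw [← s.content_eq] at hc
        change D.headContent i = _ at hc
        omega
      obtain ⟨y, hy, h⟩ := (D.isRibbon i).exists_pred (D.isHead i) hx hne
      refine ⟨y, hy, ?_⟩
      simp only [cellContent] at hc ⊢
      push_cast
      omega
  obtain ⟨x, hx, h⟩ := key ((D.tailContent i - D.headContent i).toNat - l) (by omega)
  exact ⟨x, hx, by omega⟩

variable {R : Type*} [CommRing R]

/-- The determinant of ribbon functions of an outer decomposition is the determinant of a cell
matrix. -/
theorem det_entry_eq_det_cellMatrix (a' b' : ℕ → ℤ) (y z : ℤ → R) :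
    Matrix.det (Matrix.of fun i j : Fin k => D.entry a' b' y z i j) =
      (cellMatrix s.cells s.shift (rowKernel (fun c => a' (s.rowMin c)) (fun c => b' (s.rowMax c))
        y z) fun t => D.StripUp (t - 1)).det := by
  set M := rowKernel (fun c => a' (s.rowMin c)) (fun c => b' (s.rowMax c)) y z with hM
  have hle : ∀ i, D.headContent i ≤ D.tailContent i := fun i => by
    have := (D.isHead i).2 _ (D.isTail i).1
    simp only [headContent, tailContent, s.content_eq, cellContent]
    omega
  -- The chain of ribbon `i` lists its cells by content, starting at the head. Beyond the ribbon the
  -- value is arbitrary.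
  have hcell : ∀ i l, ∃ x : s.cells, l ≤ (D.tailContent i - D.headContent i).toNat →
      x.1 ∈ D.ribbon i ∧ cellContent s.shift x = D.headContent i + l := fun i l => by
    by_cases hl : l ≤ (D.tailContent i - D.headContent i).toNat
    · obtain ⟨x, hx, h⟩ := D.exists_cell_of_content i l hl
      exact ⟨⟨x, D.mem_cells hx⟩, fun _ => ⟨hx, h⟩⟩
    · exact ⟨⟨D.head i, D.mem_cells (D.isHead i).1⟩, fun h => (hl h).elim⟩
  choose e he using hcell
  rw [det_chains (fun i => (D.tailContent i - D.headContent i).toNat) e]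
  · congr 1
    ext i j
    obtain ⟨h1, h2⟩ := he i 0 (Nat.zero_le _)
    obtain ⟨h3, h4⟩ := he j _ le_rfl
    rw [Nat.cast_zero, add_zero] at h2
    rw [Int.toNat_of_nonneg (by have := hle j; omega), add_sub_cancel] at h4
    simp only [Matrix.of_apply, cellMatrix]
    rw [if_neg, h2, h4]
    · simp only [entry]
      split_ifs with h5 h6
      · exact strip_rowFlaggedSchur D.StripUp _ _ (fun c => a' (s.rowMin c))
          (fun c => b' (s.rowMax c)) y z h5
      · rw [h6, ribbonKernel_self]
      · rw [ribbonKernel_of_lt M _ (by omega)]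
    -- A predecessor of a head would belong to the same ribbon and have smaller content than the
    -- head.
    · rintro ⟨b, hb, h5⟩
      have h6 := D.mem_of_precedes h1 hb h5
      have h7 := h5.content
      have h8 := (D.isHead i).2 b h6
      rw [h2, headContent, s.content_eq] at h7
      simp only [cellContent] at h7
      omega
  · intro i l j l' hl hl' h
    have h1 := he i l hl
    have h2 := he j l' hl'
    rw [← h] at h2
    obtain rfl := D.ribbon_unique h1.1 h2.1
    exact ⟨rfl, by omega⟩
  · rintro ⟨x, hx⟩
    obtain ⟨i, hi⟩ := D.exists_ribbon hx
    have h1 := (D.isHead i).2 x hi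
    have h2 := (D.isTail i).2 x hi
    have h3 : D.headContent i ≤ cellContent s.shift x ∧
        cellContent s.shift x ≤ D.tailContent i := by
      simp only [headContent, tailContent, s.content_eq, cellContent]
      omega
    have hl : (cellContent s.shift x - D.headContent i).toNat ≤
        (D.tailContent i - D.headContent i).toNat := by omega
    obtain ⟨h4, h5⟩ := he i _ hl
    refine ⟨i, _, hl, Subtype.ext ((D.isRibbon i).eq_of_content_eq s.shift hi h4 ?_)⟩
    change cellContent s.shift x = _
    rw [h5]
    omega
  · intro i l hl y
    obtain ⟨h1, h2⟩ := he i l hl.le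
    obtain ⟨h3, h4⟩ := he i (l + 1) hl
    have hne : (e i (l + 1)).1 ≠ D.head i := by
      intro h
      rw [h, ← s.content_eq] at h4
      change D.headContent i = _ at h4
      omega
    obtain ⟨w, hw, h5⟩ := (D.isRibbon i).exists_pred (D.isHead i) h3 hne
    have h6 := D.precedes_of_mem h3 hw h5
    have h7 : w = e i l := (D.isRibbon i).eq_of_content_eq s.shift hw h1 (by
      have := h6.content
      push_cast at h4
      omega)
    subst h7
    simp only [cellMatrix, Matrix.of_apply]
    rw [if_pos ⟨_, (e i l).2, h6⟩]
    refine if_congr ⟨fun h8 => ?_, fun h8 => h8 ▸ h6⟩ rfl rfl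
    refine Subtype.ext ((D.isRibbon i).eq_of_content_eq s.shift
      (D.mem_of_precedes h3 y.2 h8) h1 ?_)
    rw [h8.content, h6.content]

end OuterDecomposition

end RowFlagged

end

/-- Both sides are cell determinants over the same cells with the same `rowKernel`; only the
directions differ. -/
theorem mainTheorem4 {R : Type*} [CommRing R] (y z : ℤ → R)
    (s : RowFlagged.RShape) (hs : RowFlagged.CellsConnected s.cells)
    (n : ℕ) (hn : s.length ≤ n) (a' b' : ℕ → ℤ)
    (ha : s.IsRowFlag a') (hb : s.IsRowFlag b')
    (k : ℕ) (D : RowFlagged.OuterDecomposition s k) :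
    s.rowFlaggedSchur n a' b' y z = Matrix.det (Matrix.of fun i j : Fin k => D.entry a' b' y z i j) := by
  rw [s.rowFlaggedSchur_eq_det_cellMatrix hs n hn, D.det_entry_eq_det_cellMatrix]
  exact (RowFlagged.det_cellMatrix_eq _ s.cells_convex hs _).symm
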